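/- **Setting.** Let $M\backslash R$ be a Markov decision process without reward function: a finite state set $\mathcal S$, an action set $\mathcal A$, transition probabilities, a discount factor $\gamma\in[0,1)$, an initial distribution $D$, and features $\phi:\mathcal S\to[0,1]^k$, $k\ge 1$. Weights $w\in\mathbb R^k$ induce the reward $R(s)=w\cdot\phi(s)$. For a (randomized, stationary) policy $\pi$ let $\Psi(\pi)=\mathbb E[\sum_{t\ge0}\gamma^t\phi(s_t)\mid\pi]$, so that the expected discounted reward of $\pi$ under $w$ is $w\cdot\Psi(\pi)$, and let $P_F=\{\Psi(\pi)\}$. Assume the normalization $\|\Psi(\pi)\|_1\le k$ for all $\pi$. Let $P_R\subseteq[-1,1]^k$ be a nonempty closed convex set with a separation oracle $SO_R$: on input $x$ it answers "Yes" if $x\in P_R$, and otherwise returns $(h,b)$ with $h\cdot y\le b$ for all $y\in P_R$ and $h\cdot x>b$. Let $\widehat{\mathrm{ALG}}$ be an additive FPTAS for solving the MDP: on weights $w$ and accuracy $\eta>0$ it returns a policy $\pi$ with $w\cdot\Psi(\pi)\ge w\cdot\Psi(\pi')-\eta$ for all policies $\pi'$, together with $\Psi(\pi)$. **Algorithm.**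 Let $T\ge1$, $c>0$, $\delta=1/(k\sqrt T)$. For $t=1,\dots,T$ draw $p_t,q_t$ uniformly from $[0,1/\delta]^k$, all independently; let $(\pi_t,\mu_t)$ be the answer of $\widehat{\mathrm{ALG}}$ to the weights $\frac1{2T}\big(\sum_{i<t}w_i+p_t\big)$ with accuracy $\frac{c}{2T}$; let $w_t\in\operatorname{argmin}_{w\in P_R}w\cdot\big(\sum_{i<t}\mu_i+q_t\big)$. Output the randomized policy $\frac1T\sum_{t=1}^T\pi_t$ (run one of the $\pi_t$, chosen uniformly at random). **Theorem.** 1. For every $\xi\in(0,1/2)$, every $c>0$ and every (measurable) way of choosing the minimizers $w_t$, with probability at least $1-2\xi$ over the draws the expected reward of the output policy under every $w\in P_R$ is at least $$\max_{\mu\in P_F}\min_{w\in P_R}\mu\cdot w-\frac{k^2\big(6+4\sqrt{\ln(1/\xi)}\big)}{\sqrt T}-2c ,$$ where the maximum is read as a supremum if it is not attained (which can only happen when $\mathcal A$ is infinite). 2. In every iteration the algorithm makes exactly one query to $\widehat{\mathrm{ALG}}$, namely the one described above, and a polynomial number of queries to $SO_R$. Precisely: there are a polynomial $Q$ and an adaptive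 procedure, depending only on $k$ and $\ell$, which for every nonempty $P_R\subseteq[-1,1]^k$ that is an intersection of finitely many halfspaces whose coefficients are rationals of at most $\ell$ bits, and for every separation oracle $SO_R$ of $P_R$, computes the minimizer $w_t$ in each iteration with at most $Q(k+\ell)$ queries to $SO_R$ and no query to $\widehat{\mathrm{ALG}}$. -/

import Mathlib

open scoped BigOperators

universe u v

/-- Vectors of `ℝ^k` (feature vectors and reward weights); no norm on this type is used. -/
abbrev Vec (k : ℕ) : Type := Fin k → ℝ

/-! ### Markov decision processes with linear rewards -/

/-- A Markov decision process without its reward function: finitely many states `S`, actions `A`,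
transition probabilities, discount factor, initial distribution, and features in `[0,1]^k`. -/
structure MDP (S : Type u) (A : Type v) (k : ℕ) where
  trans : S → A → PMF S
  γ : ℝ
  γ_nonneg : 0 ≤ γ
  γ_lt_one : γ < 1
  init : PMF S
  φ : S → Vec k
  φ_mem : ∀ s i, φ s i ∈ Set.Icc (0 : ℝ) 1

/-- A (stationary, possibly randomized) policy. -/
abbrev Policy (S : Type u) (A : Type v) : Type (max u v) := S → PMF A

namespace MDP

variable {S : Type u} {A : Type v} {k : ℕ}

/-- The law of the state `s_t` when `s_0 ∼ D` and the actions follow `π`. -/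
noncomputable def stateLaw (M : MDP S A k) (π : Policy S A) : ℕ → PMF S
  | 0 => M.init
  | t + 1 => (stateLaw M π t).bind fun s => (π s).bind fun a => M.trans s a

/-- The law of `s_t` for a randomized choice of policy: a policy is drawn from `ν` once, before the
start, and then followed forever. -/
noncomputable def mixedStateLaw (M : MDP S A k) (ν : PMF (Policy S A)) (t : ℕ) : PMF S :=
  ν.bind fun π => M.stateLaw π t

/-- `∑_t γ^t E[R(s_t)]`, where `s_t` has law `law t`. -/
noncomputable def discounted [Fintype S] (M : MDP S A k) (law : ℕ → PMF S) (R : S → ℝ) : ℝ :=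
  ∑' t : ℕ, M.γ ^ t * ∑ s, (law t s).toReal * R s

/-- The accumulated discounted feature vector `Ψ(π)`. -/
noncomputable def Psi [Fintype S] (M : MDP S A k) (π : Policy S A) : Vec k :=
  fun i => M.discounted (M.stateLaw π) fun s => M.φ s i

/-- The expected discounted reward of `π` under the reward function `R(s) = w · φ(s)`. -/
noncomputable def value [Fintype S] (M : MDP S A k) (w : Vec k) (π : Policy S A) : ℝ :=
  M.discounted (M.stateLaw π) fun s => w ⬝ᵥ M.φ s

/-- The expected discounted reward, under `R(s) = w · φ(s)`, of a policy drawn from `ν`. -/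
noncomputable def mixedValue [Fintype S] (M : MDP S A k) (w : Vec k)
    (ν : PMF (Policy S A)) : ℝ :=
  M.discounted (M.mixedStateLaw ν) fun s => w ⬝ᵥ M.φ s

/-- The set `P_F` of the feature vectors of all policies. -/
def featureSet [Fintype S] (M : MDP S A k) : Set (Vec k) :=
  Set.range fun π : Policy S A => M.Psi π

/-- The maxmin value `max_{μ ∈ P_F} min_{w ∈ P_R} w · μ`. -/
noncomputable def maxmin [Fintype S] (M : MDP S A k) (PR : Set (Vec k)) : ℝ :=
  sSup ((fun μ : Vec k => sInf ((fun w : Vec k => w ⬝ᵥ μ) '' PR)) '' M.featureSet)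

end MDP

/-- An approximate solver receives reward weights and an accuracy, and returns a policy together
with its feature vector. -/
abbrev Solver (S : Type u) (A : Type v) (k : ℕ) : Type (max u v) :=
  Vec k → ℝ → Policy S A × Vec k

/-- Called with accuracy `η > 0`, the solver returns a policy that is at most `η` worse than
every policy, and the feature vector of that policy. -/
def Solver.IsAdditiveApprox {S : Type u} {A : Type v} {k : ℕ} [Fintype S]
    (alg : Solver S A k) (M : MDP S A k) : Prop :=
  ∀ (w : Vec k) (η : ℝ), 0 < η →
    (∀ π : Policy S A, M.value w π - η ≤ M.value w (alg w η).1) ∧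
      (alg w η).2 = M.Psi (alg w η).1

/-! ### Separation oracles and procedures that query them -/

/-- An answer of a separation oracle: `none` is "Yes", `some (h, b)` is the hyperplane `(h, b)`. -/
abbrev SepAnswer (k : ℕ) : Type := Option (Vec k × ℝ)

/-- `SO` answers "Yes" only at points of `P`, and otherwise gives `(h, b)` with `h · y ≤ b` for all
`y ∈ P`, but `h · x > b` (so it answers "Yes" at all points of `P`). -/
def IsSeparationOracle {k : ℕ} (SO : Vec k → SepAnswer k) (P : Set (Vec k)) : Prop :=
  ∀ x : Vec k, match SO x with
    | none => x ∈ P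
    | some (h, b) => (∀ y ∈ P, h ⬝ᵥ y ≤ b) ∧ b < h ⬝ᵥ x

/-- A procedure that adaptively queries a separation oracle and finally returns a vector. -/
inductive SepProg (k : ℕ) : Type
  | ret (w : Vec k) : SepProg k
  | ask (x : Vec k) (next : SepAnswer k → SepProg k) : SepProg k

/-- The vector returned when the queries are answered by `SO`. -/
def SepProg.run {k : ℕ} (SO : Vec k → SepAnswer k) : SepProg k → Vec k
  | .ret w => w
  | .ask x next => (next (SO x)).run SO

/-- `step u`, run with the oracle `SO`, is a (measurable) choice of a minimizer of `w ↦ w · u`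
over `P`. -/
def ComputesArgmin {k : ℕ} (step : Vec k → SepProg k) (SO : Vec k → SepAnswer k)
    (P : Set (Vec k)) : Prop :=
  (Measurable fun u : Vec k => (step u).run SO) ∧
    ∀ u : Vec k, (step u).run SO ∈ P ∧ ∀ w ∈ P, (step u).run SO ⬝ᵥ u ≤ w ⬝ᵥ u

/-- Bit length of a rational number: sign, numerator and denominator. -/
def ratBits (x : ℚ) : ℕ := 1 + x.num.natAbs.size + x.den.size

/-- `P` is an intersection of finitely many halfspaces all of whose coefficients are rational
numbers of at most `ℓ` bits (the number of halfspaces is not restricted). -/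
def DescribedByBits {k : ℕ} (P : Set (Vec k)) (ℓ : ℕ) : Prop :=
  ∃ (m : ℕ) (a : Fin m → Fin k → ℚ) (b : Fin m → ℚ),
    (∀ j, ratBits (b j) ≤ ℓ ∧ ∀ i, ratBits (a j i) ≤ ℓ) ∧
      P = {x : Vec k | ∀ j, ∑ i, (a j i : ℝ) * x i ≤ (b j : ℝ)}

/-! ### The follow-the-perturbed-leader algorithm -/

/-- One iteration as a procedure with two oracles, the MDP solver and the separation oracle;
it returns `(π_t, μ_t, w_t)`. -/
inductive RoundProg (S : Type u) (A : Type v) (k : ℕ) : Type (max u v)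
  | ret (π : Policy S A) (μ w : Vec k) : RoundProg S A k
  | askSolver (w : Vec k) (η : ℝ) (next : Policy S A × Vec k → RoundProg S A k) : RoundProg S A k
  | askSep (x : Vec k) (next : SepAnswer k → RoundProg S A k) : RoundProg S A k

namespace RoundProg

variable {S : Type u} {A : Type v} {k : ℕ}

/-- The result `(π_t, μ_t, w_t)` when the queries are answered by `alg` and `SO`. -/
def run (alg : Solver S A k) (SO : Vec k → SepAnswer k) :
    RoundProg S A k → Policy S A × Vec k × Vec k
  | .ret π μ w => (π, μ, w)
  | .askSolver w η next => (next (alg w η)).run alg SO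
  | .askSep x next => (next (SO x)).run alg SO

/-- The queries `(weights, accuracy)` made to the solver, in order. -/
def solverQueries (alg : Solver S A k) (SO : Vec k → SepAnswer k) :
    RoundProg S A k → List (Vec k × ℝ)
  | .ret _ _ _ => []
  | .askSolver w η next => (w, η) :: (next (alg w η)).solverQueries alg SO
  | .askSep x next => (next (SO x)).solverQueries alg SO

/-- The queries made to the separation oracle, in order. -/
def sepQueries (alg : Solver S A k) (SO : Vec k → SepAnswer k) :
    RoundProg S A k → List (Vec k)
  | .ret _ _ _ => []
  | .askSolver w η next => (next (alg w η)).sepQueries alg SO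
  | .askSep x next => x :: (next (SO x)).sepQueries alg SO

/-- Carry out a procedure that only uses the separation oracle, then continue with its result. -/
def ofSep : SepProg k → (Vec k → RoundProg S A k) → RoundProg S A k
  | .ret w, cont => cont w
  | .ask x next, cont => .askSep x fun r => ofSep (next r) cont

end RoundProg

/-- `δ = 1 / (k √T)`. -/
noncomputable def fplDelta (k T : ℕ) : ℝ := 1 / ((k : ℝ) * Real.sqrt T)

/-- The uniform distribution on the cube `[0, 1/δ]^k`. -/
noncomputable def fplNoise (k T : ℕ) : MeasureTheory.Measure (Vec k) :=
  ProbabilityTheory.cond MeasureTheory.volume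
    (Set.Icc (0 : Vec k) fun _ => 1 / fplDelta k T)

/-- The joint law of the independent draws `(p_t, q_t)`, `t < T`. -/
noncomputable def fplNoiseSeq (k T : ℕ) : MeasureTheory.Measure (Fin T → Vec k × Vec k) :=
  MeasureTheory.Measure.pi fun _ => (fplNoise k T).prod (fplNoise k T)

/-- One iteration, where `W` and `U` are the sums of the previous weights and feature vectors and
`p`, `q` are the current perturbations: the solver is called on `(W + p) / (2T)` with accuracy
`c / (2T)`, and `step` is carried out for the objective `U + q`. -/
noncomputable def fplRound (S : Type u) (A : Type v) {k : ℕ} (T : ℕ) (c : ℝ)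
    (step : Vec k → SepProg k) (W U p q : Vec k) : RoundProg S A k :=
  .askSolver ((1 / (2 * (T : ℝ))) • (W + p)) (c / (2 * (T : ℝ))) fun r =>
    RoundProg.ofSep (step (U + q)) fun w => .ret r.1 r.2 w

section Algorithm

variable {S : Type u} {A : Type v} {k T : ℕ}

/-- `(∑_{i<t} w_i, ∑_{i<t} μ_i)`, for `t ≤ T`, where iterations are numbered from `0`. -/
noncomputable def fplSums (alg : Solver S A k) (SO : Vec k → SepAnswer k) (c : ℝ)
    (step : Vec k → SepProg k) (ω : Fin T → Vec k × Vec k) : ℕ → Vec k × Vec k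
  | 0 => (0, 0)
  | t + 1 =>
    let s := fplSums alg SO c step ω t
    if h : t < T then
      let o := (fplRound S A T c step s.1 s.2 (ω ⟨t, h⟩).1 (ω ⟨t, h⟩).2).run alg SO
      (s.1 + o.2.2, s.2 + o.2.1)
    else s

/-- The procedure carried out in iteration `t`. -/
noncomputable def fplIteration (alg : Solver S A k) (SO : Vec k → SepAnswer k) (c : ℝ)
    (step : Vec k → SepProg k) (ω : Fin T → Vec k × Vec k) (t : Fin T) : RoundProg S A k :=
  let s := fplSums alg SO c step ω t
  fplRound S A T c step s.1 s.2 (ω t).1 (ω t).2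

/-- The output `(1/T) ∑_t π_t`: one of the policies `π_t`, chosen uniformly at random. -/
noncomputable def fplOutput [NeZero T] (alg : Solver S A k) (SO : Vec k → SepAnswer k) (c : ℝ)
    (step : Vec k → SepProg k) (ω : Fin T → Vec k × Vec k) : PMF (Policy S A) :=
  (PMF.uniformOfFintype (Fin T)).map fun t =>
    ((fplIteration alg SO c step ω t).run alg SO).1

end Algorithm

/-!
The two parts of the theorem have independent proofs.

*Oracle queries.* Some vertex of the polytope `P_R` minimizes the objective, and every vertex solves
a nonsingular system of `k` of the constraints. So the minimizer can be sought in a finite set of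
candidates whose size has a polynomial number of bits (`card_candidateVertices_le`,
`exists_minimizer_mem_candidateVertices`). The procedure `cutSearch` queries a centerpoint of the
remaining candidates, which exists by Helly's theorem (`exists_centerpoint`). A separating
hyperplane, or, after the answer "Yes", the level set of the objective, cuts off at least the
fraction `1 / (k + 1)` of the candidates, so that polynomially many queries exhaust them. The last
point answered by "Yes" is then an exact minimizer (`cutSearch_run_spec`). This works for
lower-dimensional polytopes as well, and for oracles that are not measurable, since only finitely
many points can ever be queried.

*Performance.* Policies and weights are two players who both follow the perturbed leader in the game
with payoff `w · μ`. Playing the leader of the *next* round has almost no regret (`be_the_leader`),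
and the uniform noise on a large cube makes the mean strategies of consecutive rounds almost equal,
because a cube and its translate by a short vector mostly overlap (`abs_integral_shift_sub_le`).
This bounds the regret of each player, measured by conditional mean payoffs
(`follow_the_perturbed_leader`). The two regrets together bound the loss of the output policy up to
the sum of the differences of the two conditional mean payoffs (`dotProduct_sub_le_sum_payoffGap`).
As `p_t` and `q_t` are independent, these differences form a single bounded martingale difference
sequence, and Hoeffding's lemma with Azuma's method on the product space bounds the sum with high
probability (`lintegral_exp_meanPayoff_sub_le`, `lintegral_exp_sum_le`,
`measure_le_sum_payoffGap_le`).
-/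

/-! ### Centerpoints -/

/-- The centerpoint theorem. The convex hulls of the subsets that contain more than `k / (k + 1)`
of the points have a common point by Helly's theorem, since any `k + 1` of these subsets share a
point of `C`. -/
theorem exists_centerpoint {k : ℕ} (C : Finset (Vec k)) :
    ∃ x : Vec k, ∀ h : Vec k,
      C.card ≤ (k + 1) * (C.filter fun y => h ⬝ᵥ x ≤ h ⬝ᵥ y).card := by
  classical
  have key : (⋂ D ∈ C.powerset.filter (fun D => k * C.card < (k + 1) * D.card),
      convexHull ℝ (D : Set (Vec k))).Nonempty := by
    refine Convex.helly_theorem' (𝕜 := ℝ) (fun D _ => convex_convexHull ℝ _) fun I hI hcard => ?_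
    rw [Module.finrank_fin_fun] at hcard
    rcases I.eq_empty_or_nonempty with rfl | hne
    · simp
    suffices ∃ y ∈ C, ∀ D ∈ I, y ∈ D by
      obtain ⟨y, -, hy⟩ := this
      exact ⟨y, Set.mem_iInter₂.2 fun D hD => subset_convexHull ℝ _ (hy D hD)⟩
    by_contra! hcon
    have hsub : C ⊆ I.biUnion fun D => C \ D := fun y hy => by
      obtain ⟨D, hD, hyD⟩ := hcon y hy
      exact Finset.mem_biUnion.2 ⟨D, hD, Finset.mem_sdiff.2 ⟨hy, hyD⟩⟩
    have h1 : C.card ≤ ∑ D ∈ I, (C \ D).card :=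
      (Finset.card_le_card hsub).trans Finset.card_biUnion_le
    have h2 : ∑ D ∈ I, (k + 1) * (C \ D).card < ∑ _D ∈ I, C.card := by
      refine Finset.sum_lt_sum_of_nonempty hne fun D hD => ?_
      have hD' := Finset.mem_filter.1 (hI hD)
      have := Finset.card_sdiff_add_card_eq_card (Finset.mem_powerset.1 hD'.1)
      nlinarith [hD'.2]
    rw [← Finset.mul_sum, Finset.sum_const, smul_eq_mul] at h2
    have h3 : I.card * C.card ≤ (k + 1) * C.card := Nat.mul_le_mul_right _ hcard
    have h4 := Nat.mul_le_mul_left (k + 1) h1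
    omega
  obtain ⟨x, hx⟩ := key
  refine ⟨x, fun h => ?_⟩
  by_contra! hlt
  set D := C.filter fun y => ¬ h ⬝ᵥ x ≤ h ⬝ᵥ y with hD
  have hcount : (C.filter fun y => h ⬝ᵥ x ≤ h ⬝ᵥ y).card + D.card = C.card :=
    Finset.card_filter_add_card_filter_not _
  have hxD : x ∈ convexHull ℝ (D : Set (Vec k)) := by
    refine Set.mem_iInter₂.1 hx D (Finset.mem_filter.2 ⟨?_, by nlinarith⟩)
    exact Finset.mem_powerset.2 (Finset.filter_subset _ _)
  have hconv : Convex ℝ {y : Vec k | h ⬝ᵥ y < h ⬝ᵥ x} :=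
    convex_halfSpace_lt ⟨fun a b => dotProduct_add h a b, fun c a => dotProduct_smul c h a⟩ _
  have hsub : (D : Set (Vec k)) ⊆ {y : Vec k | h ⬝ᵥ y < h ⬝ᵥ x} := fun y hy => by
    simpa [hD] using (Finset.mem_filter.1 hy).2
  exact lt_irrefl (h ⬝ᵥ x) (convexHull_min hsub hconv hxD)

/-- A centerpoint of `C`: every closed halfspace that contains it contains at least the fraction
`1 / (k + 1)` of the points of `C`. -/
noncomputable def centerpoint {k : ℕ} (C : Finset (Vec k)) : Vec k :=
  (exists_centerpoint C).choose

theorem card_le_mul_card_filter_centerpoint {k : ℕ} (C : Finset (Vec k)) (h : Vec k) :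
    C.card ≤ (k + 1) * (C.filter fun y => h ⬝ᵥ centerpoint C ≤ h ⬝ᵥ y).card :=
  (exists_centerpoint C).choose_spec h

theorem exists_dotProduct_centerpoint_le {k : ℕ} {C : Finset (Vec k)} (hC : C.Nonempty)
    (h : Vec k) : ∃ y ∈ C, h ⬝ᵥ centerpoint C ≤ h ⬝ᵥ y := by
  have h1 := card_le_mul_card_filter_centerpoint C h
  have h2 := hC.card_pos
  have h3 : (C.filter fun y => h ⬝ᵥ centerpoint C ≤ h ⬝ᵥ y).Nonempty := by
    rw [← Finset.card_pos]
    exact Nat.pos_of_mul_pos_left (h2.trans_le h1)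
  obtain ⟨y, hy⟩ := h3
  exact ⟨y, Finset.mem_filter.1 hy⟩

/-- If all points selected by `p` avoid a closed halfspace that contains the centerpoint, then `p`
selects at most the fraction `k / (k + 1)` of `C`. -/
theorem card_filter_mul_le_of_cut {k : ℕ} (C : Finset (Vec k)) (h : Vec k) (p : Vec k → Prop)
    [DecidablePred p] (hp : ∀ y, p y → h ⬝ᵥ y < h ⬝ᵥ centerpoint C) :
    (C.filter p).card * (k + 1) ≤ C.card * k := by
  classical
  have h1 := card_le_mul_card_filter_centerpoint C h
  have h2 : (C.filter p).card ≤ (C.filter fun y => ¬ h ⬝ᵥ centerpoint C ≤ h ⬝ᵥ y).card :=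
    Finset.card_le_card (Finset.monotone_filter_right C fun y _ hy => not_le.2 (hp y hy))
  have h3 : (C.filter fun y => h ⬝ᵥ centerpoint C ≤ h ⬝ᵥ y).card +
      (C.filter fun y => ¬ h ⬝ᵥ centerpoint C ≤ h ⬝ᵥ y).card = C.card :=
    Finset.card_filter_add_card_filter_not _
  nlinarith

/-! ### Minimization by cutting at centerpoints -/

open Classical in
/-- Search for a minimizer of `w ↦ u · w`, with at most `n` queries, among the candidates `C`. The
query is a centerpoint `x` of `C`. A separating halfspace discards the candidates outside of it; the
answer "Yes" makes `x` the best point known and discards the candidates that do not improve on it.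
The vector `best` is the last point answered by "Yes". -/
noncomputable def cutSearch {k : ℕ} (u : Vec k) : ℕ → Finset (Vec k) → Vec k → SepProg k
  | 0, _, best => .ret best
  | n + 1, C, best =>
    if C.Nonempty then
      .ask (centerpoint C) fun r =>
        match r with
        | none => cutSearch u n (C.filter fun y => u ⬝ᵥ y < u ⬝ᵥ centerpoint C) (centerpoint C)
        | some (h, b) => cutSearch u n (C.filter fun y => h ⬝ᵥ y ≤ b) best
    else .ret best

/-- The result of `cutSearch` is in `P`, and no worse than any candidate `v ∈ P`. The invariant is
that `v` is still a candidate, or the best point known is in `P`, is no worse than `v`, and is worse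
than all remaining candidates; the number of candidates decreases by the factor `k / (k + 1)`. -/
theorem cutSearch_run_spec {k : ℕ} {P : Set (Vec k)} {SO : Vec k → SepAnswer k}
    (hSO : IsSeparationOracle SO P) (u v : Vec k) (hv : v ∈ P) (n : ℕ) (C : Finset (Vec k))
    (best : Vec k) (hcard : C.card * k ^ n < (k + 1) ^ n)
    (hinv : v ∈ C ∨ (best ∈ P ∧ u ⬝ᵥ best ≤ u ⬝ᵥ v ∧ ∀ y ∈ C, u ⬝ᵥ y < u ⬝ᵥ best)) :
    (cutSearch u n C best).run SO ∈ P ∧ u ⬝ᵥ (cutSearch u n C best).run SO ≤ u ⬝ᵥ v := by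
  classical
  induction n generalizing C best with
  | zero =>
    have : C = ∅ := by simpa using hcard
    subst this
    simp only [Finset.notMem_empty, false_or] at hinv
    exact ⟨hinv.1, hinv.2.1⟩
  | succ n ih =>
    by_cases hC : C.Nonempty
    swap
    · rw [Finset.not_nonempty_iff_eq_empty] at hC
      subst hC
      simp only [Finset.notMem_empty, false_or] at hinv
      simpa [cutSearch, SepProg.run] using And.intro hinv.1 hinv.2.1
    have hstep : ∀ C' : Finset (Vec k), C'.card * (k + 1) ≤ C.card * k →
        C'.card * k ^ n < (k + 1) ^ n := fun C' h => by
      have h1 := Nat.mul_le_mul_right (k ^ n) h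
      rw [pow_succ, pow_succ] at hcard
      refine lt_of_mul_lt_mul_right ?_ (Nat.zero_le (k + 1))
      calc C'.card * k ^ n * (k + 1) = C'.card * (k + 1) * k ^ n := by ring
        _ ≤ C.card * k * k ^ n := h1
        _ = C.card * (k ^ n * k) := by ring
        _ < (k + 1) ^ n * (k + 1) := hcard
    have hx := hSO (centerpoint C)
    rw [cutSearch, if_pos hC, SepProg.run]
    rcases hr : SO (centerpoint C) with _ | ⟨h, b⟩
    · rw [hr] at hx
      refine ih _ _ (hstep _ (card_filter_mul_le_of_cut C u _ fun y hy => hy)) ?_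
      by_cases hvx : v ∈ C ∧ u ⬝ᵥ v < u ⬝ᵥ centerpoint C
      · exact Or.inl (Finset.mem_filter.2 hvx)
      refine Or.inr ⟨hx, ?_, fun y hy => (Finset.mem_filter.1 hy).2⟩
      rcases hinv with hvC | ⟨-, h1, h2⟩
      · exact not_lt.1 fun hlt => hvx ⟨hvC, hlt⟩
      · obtain ⟨y, hy, hyx⟩ := exists_dotProduct_centerpoint_le hC u
        exact (hyx.trans (h2 y hy).le).trans h1
    · rw [hr] at hx
      refine ih _ _ (hstep _ (card_filter_mul_le_of_cut C h _ fun y hy => hy.trans_lt hx.2)) ?_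
      rcases hinv with hvC | ⟨h0, h1, h2⟩
      · exact Or.inl (Finset.mem_filter.2 ⟨hvC, hx.1 v hv⟩)
      · exact Or.inr ⟨h0, h1, fun y hy => h2 y (Finset.mem_filter.1 hy).1⟩

/-- A choice among finitely many measurable functions, made by the subset of `C` that a finite
system of measurable conditions cuts out, is measurable. -/
theorem measurable_comp_filter {α β ι : Type*} [MeasurableSpace α] [MeasurableSpace β]
    (C : Finset ι) (p : α → ι → Prop) [∀ a, DecidablePred (p a)]
    (hp : ∀ i, MeasurableSet {a | p a i}) (g : Finset ι → α → β) (hg : ∀ D, Measurable (g D)) :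
    Measurable fun a => g (C.filter (p a)) a := by
  classical
  intro s hs
  have : (fun a => g (C.filter (p a)) a) ⁻¹' s =
      ⋃ D ∈ C.powerset, (⋂ i ∈ C, {a | p a i ↔ i ∈ D}) ∩ g D ⁻¹' s := by
    ext a
    simp only [Set.mem_preimage, Set.mem_iUnion, Set.mem_inter_iff, Set.mem_iInter,
      Set.mem_ofPred_eq, Finset.mem_powerset, exists_prop]
    constructor
    · exact fun h => ⟨_, Finset.filter_subset _ _, fun i hi => by simp [hi], h⟩
    · rintro ⟨D, hD, hi, h⟩
      have : C.filter (p a) = D := by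
        ext i
        rw [Finset.mem_filter]
        exact ⟨fun h => (hi i h.1).1 h.2, fun h => ⟨hD h, (hi i (hD h)).2 h⟩⟩
      rwa [this]
  rw [this]
  refine Finset.measurableSet_biUnion _ fun D _ => MeasurableSet.inter ?_ (hg D hs)
  refine Finset.measurableSet_biInter _ fun i _ => ?_
  by_cases hi : i ∈ D
  · simpa [hi] using hp i
  · simp only [hi, iff_false]
    exact (hp i).compl

theorem measurable_dotProduct_right {k : ℕ} (y : Vec k) : Measurable fun u : Vec k => u ⬝ᵥ y := by
  unfold dotProduct
  fun_prop

/-- The queries depend on `u` only through comparisons of finitely many numbers `u · y`; so no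
measurability of the oracle is needed. -/
theorem measurable_cutSearch_run {k : ℕ} (SO : Vec k → SepAnswer k) (n : ℕ) (C : Finset (Vec k))
    (best : Vec k) : Measurable fun u => (cutSearch u n C best).run SO := by
  classical
  induction n generalizing C best with
  | zero => exact measurable_const
  | succ n ih =>
    by_cases hC : C.Nonempty
    swap
    · simp only [cutSearch, if_neg hC, SepProg.run]
      exact measurable_const
    simp only [cutSearch, if_pos hC, SepProg.run]
    rcases SO (centerpoint C) with _ | ⟨h, b⟩
    · refine measurable_comp_filter C (fun u y => u ⬝ᵥ y < u ⬝ᵥ centerpoint C) (fun y => ?_)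
        (fun D u => (cutSearch u n D (centerpoint C)).run SO) fun D => ih D _
      exact measurableSet_lt (measurable_dotProduct_right y) (measurable_dotProduct_right _)
    · exact ih _ _

/-! ### Vertices of polytopes with coefficients of bounded bit length -/

/-- A finite set of real numbers that contains all rational numbers of at most `ℓ` bits. -/
noncomputable def boundedRationals (ℓ : ℕ) : Finset ℝ :=
  (Finset.Icc (-(2 : ℤ) ^ ℓ) (2 ^ ℓ) ×ˢ Finset.range (2 ^ ℓ)).image
    fun p => (p.1 : ℝ) / (p.2 : ℝ)

theorem cast_mem_boundedRationals {x : ℚ} {ℓ : ℕ} (hx : ratBits x ≤ ℓ) :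
    (x : ℝ) ∈ boundedRationals ℓ := by
  unfold ratBits at hx
  have h1 : x.num.natAbs < 2 ^ ℓ := Nat.size_le.1 (by omega)
  have h2 : x.den < 2 ^ ℓ := Nat.size_le.1 (by omega)
  refine Finset.mem_image.2 ⟨(x.num, x.den), ?_, (Rat.cast_def x).symm⟩
  have h3 : ((x.num.natAbs : ℕ) : ℤ) < 2 ^ ℓ := by exact_mod_cast h1
  simp only [Finset.mem_product, Finset.mem_Icc, Finset.mem_range]
  omega

theorem card_boundedRationals_le (ℓ : ℕ) : (boundedRationals ℓ).card ≤ 2 ^ (2 * ℓ + 2) := by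
  refine Finset.card_image_le.trans ?_
  rw [Finset.card_product, Int.card_Icc, Finset.card_range]
  have h : ((2 : ℤ) ^ ℓ + 1 - -2 ^ ℓ).toNat = 2 * 2 ^ ℓ + 1 := by
    have : ((2 ^ ℓ : ℕ) : ℤ) = 2 ^ ℓ := by push_cast; rfl
    omega
  rw [h]
  have h1 : 1 ≤ 2 ^ ℓ := Nat.one_le_two_pow
  calc (2 * 2 ^ ℓ + 1) * 2 ^ ℓ ≤ (4 * 2 ^ ℓ) * 2 ^ ℓ := Nat.mul_le_mul_right _ (by omega)
    _ = 2 ^ (2 * ℓ + 2) := by ring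

open Classical in
/-- The points `A⁻¹ b`, where all entries of `A` and `b` are in `boundedRationals ℓ`. (For singular
matrices `A`, whose `A⁻¹` is `0`, this adds only the origin.) -/
noncomputable def candidateVertices (k ℓ : ℕ) : Finset (Vec k) :=
  (Fintype.piFinset (fun _ : Fin k => Fintype.piFinset fun _ : Fin k => boundedRationals ℓ) ×ˢ
      Fintype.piFinset fun _ : Fin k => boundedRationals ℓ).image
    fun p => ((Matrix.of p.1)⁻¹).mulVec p.2

theorem card_candidateVertices_le (k ℓ : ℕ) :
    (candidateVertices k ℓ).card ≤ 2 ^ ((2 * ℓ + 2) * (k * k + k)) := by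
  refine Finset.card_image_le.trans ?_
  simp only [Finset.card_product, Fintype.card_piFinset, Finset.prod_const, Finset.card_univ,
    Fintype.card_fin]
  rw [← pow_mul, ← pow_add, pow_mul]
  exact Nat.pow_le_pow_left (card_boundedRationals_le ℓ) _

/-- An extreme point of a polyhedron is the solution of a nonsingular system of `k` of the
constraints. Otherwise some `d ≠ 0` would be orthogonal to all active constraints, and the point
would be the midpoint of a segment in the direction of `d`. -/
theorem exists_nonsingular_of_mem_extremePoints {k m : ℕ} (a : Fin m → Vec k) (b : Fin m → ℝ)
    {x : Vec k} (hx : x ∈ Set.extremePoints ℝ {y : Vec k | ∀ j, a j ⬝ᵥ y ≤ b j}) :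
    ∃ e : Fin k → Fin m, IsUnit (Matrix.of fun i => a (e i)) ∧ ∀ i, a (e i) ⬝ᵥ x = b (e i) := by
  classical
  have hxP : ∀ j, a j ⬝ᵥ x ≤ b j := hx.1
  let J := {j : Fin m // a j ⬝ᵥ x = b j}
  let B : Matrix J (Fin k) ℝ := Matrix.of fun j => a j.1
  have hinj : Function.Injective B.mulVecLin := by
    rw [injective_iff_map_eq_zero]
    intro d hd
    have hact : ∀ j, a j ⬝ᵥ x = b j → a j ⬝ᵥ d = 0 := fun j hj => congrFun hd ⟨j, hj⟩
    -- A step that keeps all inactive constraints.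
    have hε : ∃ ε : ℝ, 0 < ε ∧ ∀ j, |ε * (a j ⬝ᵥ d)| ≤ b j - a j ⬝ᵥ x := by
      have hev : ∀ j, ∀ᶠ ε in nhdsWithin (0 : ℝ) (Set.Ioi 0),
          |ε * (a j ⬝ᵥ d)| ≤ b j - a j ⬝ᵥ x := fun j => by
        by_cases hj : a j ⬝ᵥ x = b j
        · simp [hact j hj, hj]
        have hpos : |(0 : ℝ) * (a j ⬝ᵥ d)| < b j - a j ⬝ᵥ x := by
          simpa using lt_of_le_of_ne (hxP j) hj
        have hcont : Continuous fun ε : ℝ => |ε * (a j ⬝ᵥ d)| := by fun_prop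
        have := (hcont.tendsto 0).eventually (gt_mem_nhds hpos)
        exact (this.filter_mono nhdsWithin_le_nhds).mono fun _ h => h.le
      obtain ⟨ε, h, hε⟩ := ((Filter.eventually_all.2 hev).and self_mem_nhdsWithin).exists
      exact ⟨ε, hε, h⟩
    obtain ⟨ε, hε0, hε⟩ := hε
    have hmem1 : x + ε • d ∈ {y : Vec k | ∀ j, a j ⬝ᵥ y ≤ b j} := fun j => by
      rw [dotProduct_add, dotProduct_smul, smul_eq_mul]
      linarith [(abs_le.1 (hε j)).2]
    have hmem2 : x - ε • d ∈ {y : Vec k | ∀ j, a j ⬝ᵥ y ≤ b j} := fun j => by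
      rw [dotProduct_sub, dotProduct_smul, smul_eq_mul]
      linarith [(abs_le.1 (hε j)).1]
    have hseg : x ∈ openSegment ℝ (x + ε • d) (x - ε • d) :=
      ⟨1 / 2, 1 / 2, by norm_num, by norm_num, by norm_num, by module⟩
    have := hx.2 hmem1 hmem2 hseg
    have hzero : ε • d = 0 := by simpa using this
    exact (smul_eq_zero.1 hzero).resolve_left hε0.ne'
  have hspan : Submodule.span ℝ (Set.range fun j : J => a j.1) = ⊤ := by
    refine Submodule.eq_top_of_finrank_eq ?_
    have h1 := B.rank_eq_finrank_span_row
    have h2 : B.rank = k := by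
      rw [Matrix.rank, LinearMap.finrank_range_of_inj hinj, Module.finrank_fin_fun]
    rw [Module.finrank_fin_fun]
    exact h1.symm.trans h2
  obtain ⟨κ, g, -, hκspan, hκ⟩ := exists_linearIndependent' ℝ fun j : J => a j.1
  have hbasis := Module.Basis.mk hκ (by rw [hκspan, hspan])
  have : Fintype κ := FiniteDimensional.fintypeBasisIndex hbasis
  have hcard : Fintype.card κ = k := by
    rw [← Module.finrank_eq_card_basis hbasis, Module.finrank_fin_fun]
  let σ : Fin k ≃ κ := (Fintype.equivFinOfCardEq hcard).symm
  refine ⟨fun i => (g (σ i)).1, ?_, fun i => (g (σ i)).2⟩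
  rw [← Matrix.linearIndependent_rows_iff_isUnit]
  exact hκ.comp σ σ.injective

/-- A linear function attains its minimum over a bounded polyhedron at a candidate vertex: the face
of its minimizers is compact and has an extreme point. -/
theorem exists_minimizer_mem_candidateVertices {k ℓ : ℕ} {P : Set (Vec k)} (hne : P.Nonempty)
    (hP : DescribedByBits P ℓ) (hbd : ∀ w ∈ P, ∀ i, |w i| ≤ 1) (u : Vec k) :
    ∃ v ∈ candidateVertices k ℓ, v ∈ P ∧ ∀ w ∈ P, u ⬝ᵥ v ≤ u ⬝ᵥ w := by
  classical
  obtain ⟨m, a, b, hbits, rfl⟩ := hP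
  set P : Set (Vec k) := {x | ∀ j, ∑ i, (a j i : ℝ) * x i ≤ (b j : ℝ)} with hPdef
  have hclosed : IsClosed P := by
    rw [hPdef, Set.ofPred_forall]
    exact isClosed_iInter fun j => isClosed_le (by fun_prop) continuous_const
  have hcompact : IsCompact P := by
    refine (isCompact_Icc (a := fun _ : Fin k => (-1 : ℝ)) (b := fun _ => 1)).of_isClosed_subset
      hclosed fun w hw => ⟨fun i => (abs_le.1 (hbd w hw i)).1, fun i => (abs_le.1 (hbd w hw i)).2⟩
  let l : Vec k →L[ℝ] ℝ := ∑ i, (-u i) • ContinuousLinearMap.proj i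
  have hl : ∀ y, l y = -(u ⬝ᵥ y) := fun y => by
    simp [l, dotProduct]
  set F : Set (Vec k) := {x ∈ P | ∀ y ∈ P, l y ≤ l x} with hF
  have hexp : IsExposed ℝ P F := fun _ => ⟨l, rfl⟩
  obtain ⟨z, hz, hzmax⟩ := hcompact.exists_isMaxOn hne l.continuous.continuousOn
  obtain ⟨x, hx⟩ := (hexp.isCompact hcompact).extremePoints_nonempty
    ⟨z, hz, fun y hy => hzmax hy⟩
  have hxP := hexp.isExtreme.extremePoints_subset_extremePoints hx
  obtain ⟨e, hunit, hact⟩ := exists_nonsingular_of_mem_extremePoints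
    (fun j i => (a j i : ℝ)) (fun j => (b j : ℝ)) hxP
  refine ⟨x, ?_, hxP.1, fun w hw => ?_⟩
  · refine Finset.mem_image.2 ⟨(fun i j => (a (e i) j : ℝ), fun i => (b (e i) : ℝ)), ?_, ?_⟩
    · simp only [Finset.mem_product, Fintype.mem_piFinset]
      exact ⟨fun i j => cast_mem_boundedRationals ((hbits _).2 j),
        fun i => cast_mem_boundedRationals (hbits _).1⟩
    · have hmul : (fun i => (b (e i) : ℝ)) =
          (Matrix.of fun i => fun j => (a (e i) j : ℝ)).mulVec x := funext fun i => (hact i).symm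
      simp only [hmul]
      rw [Matrix.mulVec_mulVec, Matrix.nonsing_inv_mul _ ((Matrix.isUnit_iff_isUnit_det _).1 hunit),
        Matrix.one_mulVec]
  · have := hx.1.2 w hw
    rw [hl, hl] at this
    linarith

/-! ### The number of oracle queries -/

/-- The procedure for one minimization over a polytope with coefficients of at most `ℓ` bits. -/
noncomputable def cutStep (k ℓ : ℕ) (u : Vec k) : SepProg k :=
  cutSearch u ((k + 1) * ((2 * ℓ + 2) * (k * k + k) + 1)) (candidateVertices k ℓ) 0

theorem two_mul_pow_succ_le (k : ℕ) : 2 * k ^ (k + 1) ≤ (k + 1) ^ (k + 1) := by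
  have key : ∀ n : ℕ, k ^ (n + 1) + (n + 1) * k ^ n ≤ (k + 1) ^ (n + 1) := fun n => by
    induction n with
    | zero => simp
    | succ n ih =>
      calc k ^ (n + 2) + (n + 1 + 1) * k ^ (n + 1)
          ≤ (k ^ (n + 1) + (n + 1) * k ^ n) * (k + 1) := by
            ring_nf
            omega
        _ ≤ (k + 1) ^ (n + 2) := by
            rw [pow_succ (k + 1)]
            exact Nat.mul_le_mul_right _ ih
  calc 2 * k ^ (k + 1) ≤ k ^ (k + 1) + (k + 1) * k ^ k := by
        rw [pow_succ]
        nlinarith [Nat.zero_le (k ^ k)]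
    _ ≤ (k + 1) ^ (k + 1) := key k

/-- Each block of `k + 1` queries halves the number of candidates. -/
theorem card_mul_pow_lt_of_card_le {k L c : ℕ} (hc : c ≤ 2 ^ L) :
    c * k ^ ((k + 1) * (L + 1)) < (k + 1) ^ ((k + 1) * (L + 1)) := by
  have h1 : (2 * k ^ (k + 1)) ^ (L + 1) ≤ ((k + 1) ^ (k + 1)) ^ (L + 1) :=
    Nat.pow_le_pow_left (two_mul_pow_succ_le k) _
  rw [mul_pow, ← pow_mul, ← pow_mul, pow_succ] at h1
  have h2 := Nat.mul_le_mul_right (k ^ ((k + 1) * (L + 1))) hc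
  have h3 : 0 < (k + 1) ^ ((k + 1) * (L + 1)) := by positivity
  nlinarith

theorem computesArgmin_cutStep {k ℓ : ℕ} {P : Set (Vec k)} {SO : Vec k → SepAnswer k}
    (hne : P.Nonempty) (hP : DescribedByBits P ℓ) (hbd : ∀ w ∈ P, ∀ i, |w i| ≤ 1)
    (hSO : IsSeparationOracle SO P) : ComputesArgmin (cutStep k ℓ) SO P := by
  refine ⟨measurable_cutSearch_run SO _ _ _, fun u => ?_⟩
  obtain ⟨v, hvC, hvP, hv⟩ := exists_minimizer_mem_candidateVertices hne hP hbd u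
  have h := cutSearch_run_spec hSO u v hvP _ (candidateVertices k ℓ) 0
    (card_mul_pow_lt_of_card_le (card_candidateVertices_le k ℓ)) (Or.inl hvC)
  refine ⟨h.1, fun w hw => ?_⟩
  rw [dotProduct_comm, dotProduct_comm w]
  exact h.2.trans (hv w hw)

namespace RoundProg

variable {S : Type u} {A : Type v} {k : ℕ}

theorem run_ofSep (alg : Solver S A k) (SO : Vec k → SepAnswer k) (prog : SepProg k)
    (cont : Vec k → RoundProg S A k) :
    (ofSep prog cont).run alg SO = (cont (prog.run SO)).run alg SO := by
  induction prog with
  | ret w => rfl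
  | ask x next ih => exact ih _

theorem solverQueries_ofSep (alg : Solver S A k) (SO : Vec k → SepAnswer k) (prog : SepProg k)
    (cont : Vec k → RoundProg S A k) :
    (ofSep prog cont).solverQueries alg SO = (cont (prog.run SO)).solverQueries alg SO := by
  induction prog with
  | ret w => rfl
  | ask x next ih => exact ih _

theorem length_sepQueries_ofSep_cutSearch_le (alg : Solver S A k) (SO : Vec k → SepAnswer k)
    (u : Vec k) (n : ℕ) (C : Finset (Vec k)) (best : Vec k) (π : Policy S A) (μ : Vec k) :
    ((ofSep (cutSearch u n C best) fun w => .ret π μ w).sepQueries alg SO).length ≤ n := by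
  classical
  induction n generalizing C best with
  | zero => exact le_refl 0
  | succ n ih =>
    rw [cutSearch]
    split_ifs
    · simp only [ofSep, sepQueries, List.length_cons, Nat.add_le_add_iff_right]
      rcases SO (centerpoint C) with _ | ⟨h, b⟩
      · exact ih _ _
      · exact ih _ _
    · exact Nat.zero_le _

end RoundProg

/-- The query bound, with the polynomial `(n + 1) ((2 n + 2) (n² + n) + 1)` in `n = k + ℓ`. -/
theorem exists_step_with_polynomially_many_queries :
    ∃ (step : ∀ k : ℕ, ℕ → Vec k → SepProg k) (poly : Polynomial ℕ),
      ∀ (k ℓ : ℕ) (PR : Set (Vec k)) (SO : Vec k → SepAnswer k),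
        PR.Nonempty → DescribedByBits PR ℓ → (∀ w ∈ PR, ∀ i, |w i| ≤ 1) →
        IsSeparationOracle SO PR →
        ComputesArgmin (step k ℓ) SO PR ∧
        ∀ (S : Type u) (A : Type v) (alg : Solver S A k) (T : ℕ) (c : ℝ)
            (ω : Fin T → Vec k × Vec k) (t : Fin T),
          (fplIteration alg SO c (step k ℓ) ω t).solverQueries alg SO =
              [((1 / (2 * (T : ℝ))) • ((fplSums alg SO c (step k ℓ) ω t).1 + (ω t).1),
                c / (2 * (T : ℝ)))] ∧
            ((fplIteration alg SO c (step k ℓ) ω t).sepQueries alg SO).length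
              ≤ poly.eval (k + ℓ) := by
  refine ⟨cutStep, (Polynomial.X + 1) * ((2 * Polynomial.X + 2) *
    (Polynomial.X * Polynomial.X + Polynomial.X) + 1), fun k ℓ PR SO hne hP hbd hSO =>
      ⟨computesArgmin_cutStep hne hP hbd hSO, fun S A alg T c ω t => ⟨?_, ?_⟩⟩⟩
  · simp only [fplIteration, fplRound, RoundProg.solverQueries, RoundProg.solverQueries_ofSep]
  · refine (RoundProg.length_sepQueries_ofSep_cutSearch_le _ _ _ _ _ _ _ _).trans ?_
    simp only [Polynomial.eval_mul, Polynomial.eval_add, Polynomial.eval_X, Polynomial.eval_one,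
      Polynomial.eval_ofNat]
    gcongr <;> omega

open MeasureTheory ProbabilityTheory

/-! ### Uniform noise on a cube -/

/-- The uniform distribution on the cube `[0, L]^k`. -/
noncomputable def uniformCube (k : ℕ) (L : ℝ) : Measure (Vec k) :=
  cond volume (Set.Icc (0 : Vec k) fun _ => L)

theorem volume_cube (k : ℕ) (L : ℝ) :
    volume (Set.Icc (0 : Vec k) fun _ => L) = ENNReal.ofReal L ^ k := by
  simp [Real.volume_Icc_pi]

theorem isProbabilityMeasure_uniformCube (k : ℕ) {L : ℝ} (hL : 0 < L) :
    IsProbabilityMeasure (uniformCube k L) := by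
  refine cond_isProbabilityMeasure_of_finite ?_ ?_
  · rw [volume_cube]
    exact pow_ne_zero _ (by simpa using hL)
  · rw [volume_cube]
    exact ENNReal.pow_ne_top ENNReal.ofReal_ne_top

theorem ae_uniformCube_mem (k : ℕ) (L : ℝ) :
    ∀ᵐ p ∂uniformCube k L, p ∈ Set.Icc (0 : Vec k) fun _ => L :=
  ae_cond_mem measurableSet_Icc

theorem integral_uniformCube (k : ℕ) {L : ℝ} (hL : 0 < L) (f : Vec k → ℝ) :
    ∫ p, f p ∂uniformCube k L = (L ^ k)⁻¹ * ∫ p in Set.Icc (0 : Vec k) fun _ => L, f p := by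
  rw [uniformCube, ProbabilityTheory.cond, integral_smul_measure, volume_cube, smul_eq_mul,
    ENNReal.toReal_inv, ENNReal.toReal_pow, ENNReal.toReal_ofReal hL.le]

theorem one_sub_sum_le_prod_one_sub {ι : Type*} (s : Finset ι) (a : ι → ℝ)
    (h0 : ∀ i ∈ s, 0 ≤ a i) (h1 : ∀ i ∈ s, a i ≤ 1) :
    1 - ∑ i ∈ s, a i ≤ ∏ i ∈ s, (1 - a i) := by
  classical
  induction s using Finset.induction_on with
  | empty => simp
  | insert j s hj ih =>
    rw [Finset.sum_insert hj, Finset.prod_insert hj]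
    have hs := ih (fun i hi => h0 i (Finset.mem_insert_of_mem hi))
      fun i hi => h1 i (Finset.mem_insert_of_mem hi)
    have hsum : 0 ≤ ∑ i ∈ s, a i :=
      Finset.sum_nonneg fun i hi => h0 i (Finset.mem_insert_of_mem hi)
    have hj0 := h0 j (Finset.mem_insert_self j s)
    have hj1 := h1 j (Finset.mem_insert_self j s)
    nlinarith [mul_le_mul_of_nonneg_left hs (sub_nonneg.2 hj1), mul_nonneg hj0 hsum]

/-- A cube and its translate by `w` overlap in all but the fraction `∑ |w_i| / L` of the volume. -/
theorem volume_real_cube_inter_translate {k : ℕ} {L : ℝ} (hL : 0 < L) (w : Vec k)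
    (hw : ∀ i, |w i| ≤ L) :
    L ^ k * (1 - (∑ i, |w i|) / L) ≤
      volume.real ((Set.Icc (0 : Vec k) fun _ => L) ∩ Set.Icc w (w + fun _ => L)) := by
  have hside : ∀ i, (((fun _ => L) ⊓ (w + fun _ => L) : Vec k) i - ((0 : Vec k) ⊔ w) i) =
      L * (1 - |w i| / L) := fun i => by
    have : L * (1 - |w i| / L) = L - |w i| := by field_simp
    rw [this]
    simp only [Pi.inf_apply, Pi.sup_apply, Pi.add_apply, Pi.zero_apply]
    rcases le_total 0 (w i) with h | h
    · rw [sup_of_le_right h, inf_of_le_left (by linarith), abs_of_nonneg h]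
    · rw [sup_of_le_left h, inf_of_le_right (by linarith), abs_of_nonpos h]
      ring
  have hle : ∀ i, |w i| / L ≤ 1 := fun i => (div_le_one hL).2 (hw i)
  rw [Set.Icc_inter_Icc, Measure.real, Real.volume_Icc_pi_toReal fun i => ?_]
  · rw [Finset.prod_congr rfl fun i _ => hside i, Finset.prod_mul_distrib, Finset.prod_const,
      Finset.card_univ, Fintype.card_fin, Finset.sum_div]
    refine mul_le_mul_of_nonneg_left ?_ (by positivity)
    exact one_sub_sum_le_prod_one_sub _ _ (fun i _ => by positivity) fun i _ => hle i
  · rw [← sub_nonneg, hside i]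
    exact mul_nonneg hL.le (sub_nonneg.2 (hle i))

/-- Stability: shifting the argument by `w` changes the perturbed mean of a bounded function by at
most `2 B ∑ |w_i| / L`, since the two cubes mostly overlap. -/
theorem abs_integral_shift_sub_le {k : ℕ} {L B : ℝ} (hL : 0 < L) (F : Vec k → ℝ)
    (hF : Measurable F) (hB : ∀ x, |F x| ≤ B) (x w : Vec k) :
    |(∫ p, F (x + p) ∂uniformCube k L) - ∫ p, F (x + w + p) ∂uniformCube k L| ≤
      2 * B * (∑ i, |w i|) / L := by
  have hB0 : 0 ≤ B := (abs_nonneg _).trans (hB 0)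
  have hprob := isProbabilityMeasure_uniformCube k hL
  have hcrude : ∀ y, |∫ p, F (y + p) ∂uniformCube k L| ≤ B := fun y => by
    simpa using norm_integral_le_of_norm_le_const (μ := uniformCube k L)
      (f := fun p => F (y + p)) (C := B) (Filter.Eventually.of_forall fun p => hB (y + p))
  by_cases hw : ∀ i, |w i| ≤ L
  swap
  · push Not at hw
    obtain ⟨j, hj⟩ := hw
    have h1 : L ≤ ∑ i, |w i| :=
      hj.le.trans (Finset.single_le_sum (fun i _ => abs_nonneg (w i)) (Finset.mem_univ j))
    rw [le_div_iff₀ hL]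
    have h2 := (abs_sub (∫ p, F (x + p) ∂uniformCube k L)
      (∫ p, F (x + w + p) ∂uniformCube k L)).trans (add_le_add (hcrude x) (hcrude (x + w)))
    nlinarith
  set Q : Set (Vec k) := Set.Icc 0 fun _ => L with hQ
  set Q' : Set (Vec k) := Set.Icc w (w + fun _ => L) with hQ'
  set G : Vec k → ℝ := fun p => F (x + p) with hG
  have hGm : Measurable G := hF.comp (measurable_const_add x)
  have hshift : ∫ p in Q, F (x + w + p) = ∫ p in Q', G p := by
    have h := (measurePreserving_add_left (volume : Measure (Vec k)) w).setIntegral_preimage_emb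
      (measurableEmbedding_addLeft w) G Q'
    rw [← h]
    have hpre : (fun p => w + p) ⁻¹' Q' = Q := by
      ext p
      simp only [hQ, hQ', Set.mem_preimage, Set.mem_Icc, le_add_iff_nonneg_right,
        add_le_add_iff_left]
    rw [hpre]
    simp only [hG, add_assoc]
  have hmQ : MeasurableSet Q := measurableSet_Icc
  have hmQ' : MeasurableSet Q' := measurableSet_Icc
  have hfinQ : volume Q ≠ ⊤ := measure_Icc_lt_top.ne
  have hfinQ' : volume Q' ≠ ⊤ := measure_Icc_lt_top.ne
  have hint : ∀ s : Set (Vec k), volume s ≠ ⊤ → IntegrableOn G s := fun s hs =>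
    Measure.integrableOn_of_bounded hs hGm.aestronglyMeasurable
      (Filter.Eventually.of_forall fun p => hB (x + p))
  have hsplit : ∫ p in Q, G p = (∫ p in Q ∩ Q', G p) + ∫ p in Q \ Q', G p :=
    (integral_inter_add_sdiff hmQ' (hint Q hfinQ)).symm
  have hsplit' : ∫ p in Q', G p = (∫ p in Q ∩ Q', G p) + ∫ p in Q' \ Q, G p := by
    rw [Set.inter_comm]
    exact (integral_inter_add_sdiff hmQ (hint Q' hfinQ')).symm
  have hbound : ∀ s : Set (Vec k), volume s ≠ ⊤ → |∫ p in s, G p| ≤ B * volume.real s :=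
    fun s hs => norm_setIntegral_le_of_norm_le_const (f := G) (C := B) hs.lt_top
      fun p _ => hB (x + p)
  have hvolQ : volume.real Q = L ^ k := by
    rw [Measure.real, hQ, volume_cube, ENNReal.toReal_pow, ENNReal.toReal_ofReal hL.le]
  have hvolQ' : volume.real Q' = L ^ k := by
    rw [Measure.real, hQ', Real.volume_Icc_pi]
    simp [ENNReal.toReal_ofReal hL.le]
  have hover := volume_real_cube_inter_translate hL w hw
  have hd1 : volume.real (Q ∩ Q') + volume.real (Q \ Q') = volume.real Q :=
    measureReal_inter_add_sdiff hmQ' hfinQ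
  have hd2 : volume.real (Q' ∩ Q) + volume.real (Q' \ Q) = volume.real Q' :=
    measureReal_inter_add_sdiff hmQ hfinQ'
  rw [Set.inter_comm] at hd2
  have hb1 := hbound (Q \ Q') (measure_ne_top_of_subset Set.sdiff_subset hfinQ)
  have hb2 := hbound (Q' \ Q) (measure_ne_top_of_subset Set.sdiff_subset hfinQ')
  have hLk : 0 < L ^ k := pow_pos hL k
  have hdiff : |(∫ p in Q, G p) - ∫ p in Q', G p| ≤ 2 * B * (L ^ k * ((∑ i, |w i|) / L)) := by
    rw [hsplit, hsplit', add_sub_add_left_eq_sub]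
    refine (abs_sub _ _).trans ((add_le_add hb1 hb2).trans ?_)
    have h1 : volume.real (Q \ Q') ≤ L ^ k * ((∑ i, |w i|) / L) := by linarith
    have h2 : volume.real (Q' \ Q) ≤ L ^ k * ((∑ i, |w i|) / L) := by linarith
    nlinarith
  rw [integral_uniformCube k hL, integral_uniformCube k hL, ← mul_sub, hshift, abs_mul,
    abs_of_pos (inv_pos.2 hLk)]
  calc (L ^ k)⁻¹ * |(∫ p in Q, G p) - ∫ p in Q', G p|
      ≤ (L ^ k)⁻¹ * (2 * B * (L ^ k * ((∑ i, |w i|) / L))) :=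
        mul_le_mul_of_nonneg_left hdiff (inv_pos.2 hLk).le
    _ = 2 * B * (∑ i, |w i|) / L := by field_simp

theorem integrable_coord_uniformCube (k : ℕ) {L : ℝ} (hL : 0 < L) (i : Fin k) :
    Integrable (fun p : Vec k => p i) (uniformCube k L) := by
  have := isProbabilityMeasure_uniformCube k hL
  refine Integrable.of_bound (measurable_pi_apply i).aestronglyMeasurable L ?_
  filter_upwards [ae_uniformCube_mem k L] with p hp
  rw [Real.norm_eq_abs, abs_of_nonneg (hp.1 i)]
  exact hp.2 i

/-- Each coordinate has mean `L / 2`, by the symmetry `p ↦ L - p` of the cube. -/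
theorem integral_coord_uniformCube (k : ℕ) {L : ℝ} (hL : 0 < L) (i : Fin k) :
    ∫ p, p i ∂uniformCube k L = L / 2 := by
  have := isProbabilityMeasure_uniformCube k hL
  have hrefl : ∫ p, (L - p i) ∂uniformCube k L = ∫ p, p i ∂uniformCube k L := by
    rw [integral_uniformCube k hL, integral_uniformCube k hL]
    congr 1
    have h := (Measure.measurePreserving_sub_left (volume : Measure (Vec k))
      (fun _ => L)).setIntegral_preimage_emb
        (MeasurableEquiv.subLeft (fun _ => L : Vec k)).measurableEmbedding (fun p => p i)
        (Set.Icc (0 : Vec k) fun _ => L)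
    have hpre : (fun p => (fun _ => L : Vec k) - p) ⁻¹' (Set.Icc (0 : Vec k) fun _ => L) =
        Set.Icc (0 : Vec k) fun _ => L := by
      ext p
      simp only [Set.mem_preimage, Set.mem_Icc, sub_nonneg, sub_le_self_iff]
      exact and_comm
    rw [hpre] at h
    exact h
  rw [integral_sub (integrable_const _) (integrable_coord_uniformCube k hL i)] at hrefl
  simp only [integral_const, probReal_univ, one_smul] at hrefl
  linarith

/-! ### Regret of the perturbed leader -/

/-- "Be the leader": playing `f (W_{t+1} + p)` in step `t`, where `f` maximizes `ε (x · μ)` up to an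
error `c`, is nearly as good as any fixed `μ`. The factor `ε = ±1` covers maximization and
minimization. -/
theorem be_the_leader {k : ℕ} (ε c : ℝ) (f : Vec k → Vec k) (K : Set (Vec k)) (hfK : ∀ x, f x ∈ K)
    (hf : ∀ x, ∀ μ ∈ K, ε * (x ⬝ᵥ μ) - c ≤ ε * (x ⬝ᵥ f x)) (W : ℕ → Vec k) (hW : W 0 = 0)
    (p : Vec k) (n : ℕ) (μ : Vec k) (hμ : μ ∈ K) :
    ε * (W n ⬝ᵥ μ) - ε * (p ⬝ᵥ f p - p ⬝ᵥ μ) - (n + 1) * c ≤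
      ε * ∑ t ∈ Finset.range n, (W (t + 1) - W t) ⬝ᵥ f (W (t + 1) + p) := by
  induction n generalizing μ with
  | zero =>
    have := hf p μ hμ
    simp only [hW, zero_dotProduct, Finset.range_zero, Finset.sum_empty]
    push_cast
    linarith
  | succ n ih =>
    have h1 := ih (f (W (n + 1) + p)) (hfK _)
    have h2 := hf (W (n + 1) + p) μ hμ
    rw [Finset.sum_range_succ]
    simp only [add_dotProduct, sub_dotProduct] at h1 h2 ⊢
    push_cast
    linarith

/-- The expectation of `w · f (x + p)` over the noise `p`. -/
noncomputable def meanPayoff {k : ℕ} (L : ℝ) (f : Vec k → Vec k) (x w : Vec k) : ℝ :=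
  ∫ p, w ⬝ᵥ f (x + p) ∂uniformCube k L

theorem measurable_dotProduct_comp {α : Type*} [MeasurableSpace α] {k : ℕ} {f g : α → Vec k}
    (hf : Measurable f) (hg : Measurable g) : Measurable fun a => f a ⬝ᵥ g a := by
  unfold dotProduct
  exact Finset.measurable_sum _ fun i _ =>
    ((measurable_pi_apply i).comp hf).mul ((measurable_pi_apply i).comp hg)

theorem measurable_meanPayoff {k : ℕ} {L : ℝ} (hL : 0 < L) {f : Vec k → Vec k} (hf : Measurable f) :
    Measurable fun z : Vec k × Vec k => meanPayoff L f z.1 z.2 := by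
  have := isProbabilityMeasure_uniformCube k hL
  have hm : Measurable fun z : (Vec k × Vec k) × Vec k => z.1.2 ⬝ᵥ f (z.1.1 + z.2) :=
    measurable_dotProduct_comp (by fun_prop) (hf.comp (by fun_prop))
  exact (hm.stronglyMeasurable.integral_prod_right (ν := uniformCube k L)).measurable

theorem abs_meanPayoff_le {k : ℕ} {L B : ℝ} (hL : 0 < L) {f : Vec k → Vec k} {w : Vec k}
    (hB : ∀ x, |w ⬝ᵥ f x| ≤ B) (x : Vec k) : |meanPayoff L f x w| ≤ B := by
  have := isProbabilityMeasure_uniformCube k hL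
  simpa [meanPayoff] using norm_integral_le_of_norm_le_const (μ := uniformCube k L)
    (f := fun p => w ⬝ᵥ f (x + p)) (C := B) (Filter.Eventually.of_forall fun p => hB (x + p))

theorem integrable_payoff {k : ℕ} {L B : ℝ} (hL : 0 < L) {f : Vec k → Vec k} (hfm : Measurable f)
    {w : Vec k} (hB : ∀ x, |w ⬝ᵥ f x| ≤ B) (x : Vec k) :
    Integrable (fun p => w ⬝ᵥ f (x + p)) (uniformCube k L) := by
  have := isProbabilityMeasure_uniformCube k hL
  refine Integrable.of_bound (Measurable.aestronglyMeasurable ?_) B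
    (Filter.Eventually.of_forall fun p => hB (x + p))
  exact measurable_dotProduct_comp measurable_const (hfm.comp (measurable_const_add x))

/-- The regret of following the perturbed leader, in terms of the conditional expectations of the
payoffs: an error of `c` per step, the effect `N` of the noise on the comparison with `μ`, and the
price `2 B b / L` per step for not knowing the current increment. -/
theorem follow_the_perturbed_leader {k : ℕ} {ε c L B b : ℝ} (hε : |ε| = 1) (hL : 0 < L)
    (f : Vec k → Vec k) (hfm : Measurable f) (K : Set (Vec k)) (hfK : ∀ x, f x ∈ K)
    (hf : ∀ x, ∀ μ ∈ K, ε * (x ⬝ᵥ μ) - c ≤ ε * (x ⬝ᵥ f x)) (W : ℕ → Vec k) (hW : W 0 = 0)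
    (n : ℕ) (hB : ∀ t < n, ∀ x, |(W (t + 1) - W t) ⬝ᵥ f x| ≤ B)
    (hb : ∀ t < n, ∑ i, |(W (t + 1) - W t) i| ≤ b) (μ : Vec k) (hμ : μ ∈ K)
    (N : Vec k → ℝ) (hN : Integrable N (uniformCube k L))
    (hNle : ∀ p ∈ Set.Icc (0 : Vec k) fun _ => L, ε * (p ⬝ᵥ f p - p ⬝ᵥ μ) ≤ N p) :
    ε * (W n ⬝ᵥ μ) - ∫ p, N p ∂uniformCube k L - (n + 1) * c - n * (2 * B * b / L) ≤
      ε * ∑ t ∈ Finset.range n, meanPayoff L f (W t) (W (t + 1) - W t) := by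
  have hprob := isProbabilityMeasure_uniformCube k hL
  have hstab : ∀ t ∈ Finset.range n,
      ε * meanPayoff L f (W (t + 1)) (W (t + 1) - W t) - 2 * B * b / L ≤
        ε * meanPayoff L f (W t) (W (t + 1) - W t) := fun t ht => by
    have ht := Finset.mem_range.1 ht
    have h := abs_integral_shift_sub_le (L := L) hL (fun x => (W (t + 1) - W t) ⬝ᵥ f x)
      (measurable_dotProduct_comp measurable_const hfm) (hB t ht) (W t) (W (t + 1) - W t)
    rw [add_sub_cancel] at h
    have hB0 : 0 ≤ B := (abs_nonneg _).trans (hB t ht 0)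
    have h' : 2 * B * (∑ i, |(W (t + 1) - W t) i|) / L ≤ 2 * B * b / L := by
      gcongr
      exact hb t ht
    have h2 : |ε * (meanPayoff L f (W t) (W (t + 1) - W t) -
        meanPayoff L f (W (t + 1)) (W (t + 1) - W t))| ≤ 2 * B * b / L := by
      rw [abs_mul, hε, one_mul]
      exact h.trans h'
    linarith [(abs_le.1 h2).1]
  have hsum := Finset.sum_le_sum hstab
  rw [Finset.sum_sub_distrib, ← Finset.mul_sum, ← Finset.mul_sum, Finset.sum_const,
    Finset.card_range, nsmul_eq_mul] at hsum
  have hint : ∀ t ∈ Finset.range n, Integrable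
      (fun p => (W (t + 1) - W t) ⬝ᵥ f (W (t + 1) + p)) (uniformCube k L) := fun t ht =>
    integrable_payoff hL hfm (hB t (Finset.mem_range.1 ht)) _
  have hmean : ∑ t ∈ Finset.range n, meanPayoff L f (W (t + 1)) (W (t + 1) - W t) =
      ∫ p, ∑ t ∈ Finset.range n, (W (t + 1) - W t) ⬝ᵥ f (W (t + 1) + p) ∂uniformCube k L :=
    (integral_finsetSum _ hint).symm
  have hbtl : ∫ p, (ε * (W n ⬝ᵥ μ) - (n + 1) * c - N p) ∂uniformCube k L ≤
      ∫ p, ε * ∑ t ∈ Finset.range n, (W (t + 1) - W t) ⬝ᵥ f (W (t + 1) + p) ∂uniformCube k L := by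
    refine integral_mono_ae ((integrable_const _).sub hN)
      ((integrable_finsetSum _ hint).const_mul ε) ?_
    filter_upwards [ae_uniformCube_mem k L] with p hp
    have h1 := be_the_leader ε c f K hfK hf W hW p n μ hμ
    have h2 := hNle p hp
    linarith
  rw [integral_sub (integrable_const _) hN, integral_const_mul, ← hmean] at hbtl
  simp only [integral_const, probReal_univ, one_smul] at hbtl
  linarith

/-! ### Concentration -/

/-- Azuma's method on a product space: if `D s` depends only on the coordinates up to `s`, and its
exponential moment over coordinate `s`, the others being fixed, is at most `exp v`, then the
exponential moment of the sum of `n` such functions is at most `exp (n v)`. -/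
theorem lintegral_exp_sum_le {Ω : Type*} [MeasurableSpace Ω] (ν : Measure Ω)
    [IsProbabilityMeasure ν] {T : ℕ} (D : ℕ → (Fin T → Ω) → ℝ) (v : ℝ)
    (hDm : ∀ t, Measurable (D t))
    (hadapt : ∀ (t : Fin T) (s : ℕ), s < t → ∀ ω x, D s (Function.update ω t x) = D s ω)
    (hD : ∀ (t : Fin T) ω,
      ∫⁻ x, ENNReal.ofReal (Real.exp (D t (Function.update ω t x))) ∂ν ≤
        ENNReal.ofReal (Real.exp v)) (n : ℕ) (hn : n ≤ T) :
    ∫⁻ ω, ENNReal.ofReal (Real.exp (∑ t ∈ Finset.range n, D t ω)) ∂(Measure.pi fun _ => ν) ≤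
      ENNReal.ofReal (Real.exp (n * v)) := by
  induction n with
  | zero => simp
  | succ n ih =>
    have ih := ih (by omega)
    let t : Fin T := ⟨n, hn⟩
    have hSm : Measurable fun ω => ENNReal.ofReal (Real.exp (∑ s ∈ Finset.range n, D s ω)) := by
      fun_prop
    have hSm' : Measurable fun ω =>
        ENNReal.ofReal (Real.exp (∑ s ∈ Finset.range (n + 1), D s ω)) := by
      fun_prop
    have hS : ∀ ω x, ∑ s ∈ Finset.range n, D s (Function.update ω t x) =
        ∑ s ∈ Finset.range n, D s ω := fun ω x =>
      Finset.sum_congr rfl fun s hs => hadapt t s (Finset.mem_range.1 hs) ω x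
    have hstep : ∫⁻ ω, ENNReal.ofReal (Real.exp (∑ s ∈ Finset.range (n + 1), D s ω))
          ∂(Measure.pi fun _ => ν) ≤
        ∫⁻ ω, ENNReal.ofReal (Real.exp v) *
          ENNReal.ofReal (Real.exp (∑ s ∈ Finset.range n, D s ω)) ∂(Measure.pi fun _ => ν) := by
      refine lintegral_le_of_lmarginal_le {t} hSm' (hSm.const_mul _) ?_
      rw [lmarginal_singleton, lmarginal_singleton]
      intro ω
      simp only [Finset.sum_range_succ, hS, Real.exp_add]
      rw [lintegral_const, measure_univ, mul_one]
      simp only [ENNReal.ofReal_mul (Real.exp_nonneg _)]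
      rw [lintegral_const_mul' _ _ ENNReal.ofReal_ne_top, mul_comm]
      exact mul_le_mul_left (hD t ω) _
    refine hstep.trans ?_
    rw [lintegral_const_mul _ hSm]
    refine (mul_le_mul_right ih _).trans_eq ?_
    rw [← ENNReal.ofReal_mul (Real.exp_nonneg _), ← Real.exp_add]
    congr 2
    push_cast
    ring

/-- One step of the game: given the sums `W` and `U`, the difference of the two conditional mean
payoffs has mean zero, since both average to the payoff of the mean strategies, and Hoeffding's
lemma bounds its exponential moment. -/
theorem lintegral_exp_meanPayoff_sub_le {k : ℕ} {L B : ℝ} (hL : 0 < L) {f h : Vec k → Vec k}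
    (hf : Measurable f) (hh : Measurable h) (hB : ∀ x y, |h x ⬝ᵥ f y| ≤ B) (W U : Vec k) (r : ℝ) :
    ∫⁻ z, ENNReal.ofReal (Real.exp (r *
        (meanPayoff L f W (h (U + z.2)) - meanPayoff L h U (f (W + z.1)))))
          ∂((uniformCube k L).prod (uniformCube k L)) ≤
      ENNReal.ofReal (Real.exp (2 * B ^ 2 * r ^ 2)) := by
  have hprob := isProbabilityMeasure_uniformCube k hL
  set ν := uniformCube k L with hν
  have hB0 : 0 ≤ B := (abs_nonneg _).trans (hB 0 0)
  have hB' : ∀ x y, |f x ⬝ᵥ h y| ≤ B := fun x y => by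
    rw [dotProduct_comm]
    exact hB y x
  have hm1 : Measurable fun q => meanPayoff L f W (h (U + q)) :=
    (measurable_meanPayoff hL hf).comp (g := fun z : Vec k × Vec k => meanPayoff L f z.1 z.2)
      (f := fun q => (W, h (U + q)))
      (measurable_const.prodMk (hh.comp (measurable_const_add U)))
  have hm2 : Measurable fun p => meanPayoff L h U (f (W + p)) :=
    (measurable_meanPayoff hL hh).comp (g := fun z : Vec k × Vec k => meanPayoff L h z.1 z.2)
      (f := fun p => (U, f (W + p)))
      (measurable_const.prodMk (hf.comp (measurable_const_add W)))
  have hb1 : ∀ q, |meanPayoff L f W (h (U + q))| ≤ B := fun q =>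
    abs_meanPayoff_le hL (hB (U + q)) W
  have hb2 : ∀ p, |meanPayoff L h U (f (W + p))| ≤ B := fun p =>
    abs_meanPayoff_le hL (hB' (W + p)) U
  have hi1 : Integrable (fun q => meanPayoff L f W (h (U + q))) ν :=
    Integrable.of_bound hm1.aestronglyMeasurable B (Filter.Eventually.of_forall hb1)
  have hi2 : Integrable (fun p => meanPayoff L h U (f (W + p))) ν :=
    Integrable.of_bound hm2.aestronglyMeasurable B (Filter.Eventually.of_forall hb2)
  set X : Vec k × Vec k → ℝ := fun z =>
    meanPayoff L f W (h (U + z.2)) - meanPayoff L h U (f (W + z.1)) with hX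
  have hXm : Measurable X := (hm1.comp measurable_snd).sub (hm2.comp measurable_fst)
  have hXb : ∀ z, X z ∈ Set.Icc (-(2 * B)) (2 * B) := fun z => by
    have h1 := abs_le.1 (hb1 z.2)
    have h2 := abs_le.1 (hb2 z.1)
    constructor <;> simp only [hX] <;> linarith
  have hmean : ∫ z, X z ∂(ν.prod ν) = 0 := by
    have e1 : ∫ z : Vec k × Vec k, meanPayoff L f W (h (U + z.2)) ∂(ν.prod ν) =
        ∫ q, meanPayoff L f W (h (U + q)) ∂ν := by
      rw [integral_fun_snd (fun q => meanPayoff L f W (h (U + q)))]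
      simp
    have e2 : ∫ z : Vec k × Vec k, meanPayoff L h U (f (W + z.1)) ∂(ν.prod ν) =
        ∫ p, meanPayoff L h U (f (W + p)) ∂ν := by
      rw [integral_fun_fst (fun p => meanPayoff L h U (f (W + p)))]
      simp
    rw [hX, integral_sub (hi1.comp_snd ν) (hi2.comp_fst ν), e1, e2, sub_eq_zero]
    have hjm : Measurable fun z : Vec k × Vec k => h (U + z.1) ⬝ᵥ f (W + z.2) :=
      measurable_dotProduct_comp (hh.comp (by fun_prop)) (hf.comp (by fun_prop))
    have hji : Integrable (Function.uncurry fun q p => h (U + q) ⬝ᵥ f (W + p)) (ν.prod ν) :=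
      Integrable.of_bound hjm.aestronglyMeasurable B (Filter.Eventually.of_forall fun z => hB _ _)
    simp only [meanPayoff]
    rw [integral_integral_swap hji]
    simp only [dotProduct_comm, hν]
  have hsub := hasSubgaussianMGF_of_mem_Icc_of_integral_eq_zero (μ := ν.prod ν) hXm.aemeasurable
    (Filter.Eventually.of_forall hXb) hmean
  have hmgf := hsub.mgf_le r
  have hparam : (((‖2 * B - -(2 * B)‖₊ / 2) ^ 2 : NNReal) : ℝ) * r ^ 2 / 2 = 2 * B ^ 2 * r ^ 2 := by
    push_cast
    rw [Real.norm_eq_abs, abs_of_nonneg (by linarith)]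
    ring
  rw [hparam] at hmgf
  rw [← ofReal_integral_eq_lintegral_ofReal (hsub.integrable_exp_mul r)
    (Filter.Eventually.of_forall fun _ => Real.exp_nonneg _)]
  exact ENNReal.ofReal_le_ofReal hmgf

/-! ### Discounted rewards -/

namespace MDP

variable {S : Type u} {A : Type v} {k : ℕ} [Fintype S]

theorem summable_discounted (M : MDP S A k) (law : ℕ → PMF S) (R : S → ℝ) :
    Summable fun t : ℕ => M.γ ^ t * ∑ s, (law t s).toReal * R s := by
  refine Summable.of_norm_bounded (g := fun t => M.γ ^ t * ∑ s, |R s|)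
    ((summable_geometric_of_lt_one M.γ_nonneg M.γ_lt_one).mul_right _) fun t => ?_
  rw [norm_mul, norm_pow, Real.norm_of_nonneg M.γ_nonneg]
  refine mul_le_mul_of_nonneg_left ?_ (pow_nonneg M.γ_nonneg t)
  refine (norm_sum_le _ _).trans (Finset.sum_le_sum fun s _ => ?_)
  rw [norm_mul, Real.norm_of_nonneg ENNReal.toReal_nonneg, Real.norm_eq_abs]
  refine mul_le_of_le_one_left (abs_nonneg _) ?_
  exact ENNReal.toReal_le_of_le_ofReal zero_le_one (by simpa using (law t).coe_le_one s)

theorem value_eq_dotProduct_Psi (M : MDP S A k) (w : Vec k) (π : Policy S A) :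
    M.value w π = w ⬝ᵥ M.Psi π := by
  simp only [value, Psi, dotProduct, discounted]
  simp only [← tsum_mul_left]
  rw [← Summable.tsum_finsetSum fun i _ =>
    (M.summable_discounted (M.stateLaw π) fun s => M.φ s i).mul_left (w i)]
  refine tsum_congr fun t => ?_
  simp only [Finset.mul_sum]
  rw [Finset.sum_comm]
  refine Finset.sum_congr rfl fun i _ => Finset.sum_congr rfl fun s _ => ?_
  ring

theorem Psi_nonneg (M : MDP S A k) (π : Policy S A) (i : Fin k) : 0 ≤ M.Psi π i :=
  tsum_nonneg fun t => mul_nonneg (pow_nonneg M.γ_nonneg t) <| Finset.sum_nonneg fun s _ =>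
    mul_nonneg ENNReal.toReal_nonneg (M.φ_mem s i).1

theorem mixedValue_map_uniform (M : MDP S A k) (w : Vec k) {T : ℕ} [NeZero T]
    (π : Fin T → Policy S A) :
    M.mixedValue w ((PMF.uniformOfFintype (Fin T)).map π) =
      (T : ℝ)⁻¹ * ∑ t, M.value w (π t) := by
  simp only [mixedValue, value, discounted]
  rw [← Summable.tsum_finsetSum fun i _ => M.summable_discounted (M.stateLaw (π i)) _,
    ← tsum_mul_left]
  refine tsum_congr fun t => ?_
  have hlaw : ∀ s, (M.mixedStateLaw ((PMF.uniformOfFintype (Fin T)).map π) t s).toReal =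
      (T : ℝ)⁻¹ * ∑ i, (M.stateLaw (π i) t s).toReal := fun s => by
    rw [mixedStateLaw, PMF.bind_map, PMF.bind_apply, tsum_fintype,
      ENNReal.toReal_sum fun i _ => ENNReal.mul_ne_top (PMF.apply_ne_top _ _)
        (PMF.apply_ne_top _ _), Finset.mul_sum]
    simp
  simp only [hlaw, Finset.mul_sum, Finset.sum_mul]
  rw [Finset.sum_comm]
  refine Finset.sum_congr rfl fun i _ => Finset.sum_congr rfl fun s _ => ?_
  ring

/-- If each policy has value at most `x` under some weights in `P`, then the maxmin value is at most
`x`. The bound `B` ensures that the infima over `P` are genuine. -/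
theorem maxmin_le_of_forall_exists (M : MDP S A k) {P : Set (Vec k)} [Nonempty (Policy S A)]
    {x B : ℝ} (hbd : ∀ w ∈ P, ∀ π, |w ⬝ᵥ M.Psi π| ≤ B)
    (h : ∀ π : Policy S A, ∃ w ∈ P, w ⬝ᵥ M.Psi π ≤ x) : M.maxmin P ≤ x := by
  refine csSup_le ((Set.range_nonempty _).image _) ?_
  rintro _ ⟨_, ⟨π, rfl⟩, rfl⟩
  obtain ⟨w, hw, hwx⟩ := h π
  refine (csInf_le ⟨-B, ?_⟩ (Set.mem_image_of_mem _ hw)).trans hwx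
  rintro _ ⟨w', hw', rfl⟩
  exact (abs_le.1 (hbd w' hw' π)).1

end MDP

/-! ### The sums of the algorithm -/

section Sums

variable {S : Type u} {A : Type v} {k T : ℕ}

/-- The feature vector of the policy that the solver returns when the perturbed sum of the previous
weights is `x`. -/
noncomputable def leaderFeatures (alg : Solver S A k) (T : ℕ) (c : ℝ) (x : Vec k) : Vec k :=
  (alg ((1 / (2 * (T : ℝ))) • x) (c / (2 * (T : ℝ)))).2

variable (alg : Solver S A k) (SO : Vec k → SepAnswer k) (c : ℝ) (step : Vec k → SepProg k)

theorem fplSums_succ (ω : Fin T → Vec k × Vec k) (t : Fin T) :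
    fplSums alg SO c step ω (t + 1) =
      ((fplSums alg SO c step ω t).1 +
          (step ((fplSums alg SO c step ω t).2 + (ω t).2)).run SO,
        (fplSums alg SO c step ω t).2 +
          leaderFeatures alg T c ((fplSums alg SO c step ω t).1 + (ω t).1)) := by
  rw [fplSums]
  simp only [Fin.is_lt, dif_pos, Fin.eta, fplRound, RoundProg.run, RoundProg.run_ofSep,
    leaderFeatures]

theorem fplSums_succ_of_le (ω : Fin T → Vec k × Vec k) {t : ℕ} (ht : T ≤ t) :
    fplSums alg SO c step ω (t + 1) = fplSums alg SO c step ω t := by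
  rw [fplSums]
  exact dif_neg (not_lt.2 ht)

/-- The sums before iteration `t` do not depend on the noise from iteration `t` on. -/
theorem fplSums_update (ω : Fin T → Vec k × Vec k) (t : Fin T) (x : Vec k × Vec k) (s : ℕ)
    (hs : s ≤ t) :
    fplSums alg SO c step (Function.update ω t x) s = fplSums alg SO c step ω s := by
  induction s with
  | zero => rfl
  | succ s ih =>
    have hsT : s < T := by omega
    have hne : (⟨s, hsT⟩ : Fin T) ≠ t := fun h => by
      have := congrArg Fin.val h
      simp only at this
      omega
    have h1 := fplSums_succ alg SO c step (Function.update ω t x) ⟨s, hsT⟩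
    have h2 := fplSums_succ alg SO c step ω ⟨s, hsT⟩
    simp only [Function.update_of_ne hne, ih (by omega)] at h1 h2
    rw [h1, h2]

theorem measurable_fplSums (hf : Measurable (leaderFeatures alg T c))
    (hh : Measurable fun u => (step u).run SO) (t : ℕ) :
    Measurable fun ω : Fin T → Vec k × Vec k => fplSums alg SO c step ω t := by
  induction t with
  | zero => exact measurable_const
  | succ t ih =>
    by_cases ht : t < T
    · have h := fun ω => fplSums_succ alg SO c step ω ⟨t, ht⟩
      simp only at h
      simp only [h]
      have h1 : Measurable fun ω : Fin T → Vec k × Vec k => ω ⟨t, ht⟩ := measurable_pi_apply _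
      refine (ih.fst.add (hh.comp (ih.snd.add h1.snd))).prodMk
        (ih.snd.add (hf.comp (ih.fst.add h1.fst)))
    · simpa only [fplSums_succ_of_le alg SO c step _ (not_lt.1 ht)] using ih

theorem leaderFeatures_approx_max [Fintype S] {M : MDP S A k} (halg : alg.IsAdditiveApprox M)
    (hT : 0 < T) (hc : 0 < c) (x : Vec k) (π : Policy S A) :
    x ⬝ᵥ M.Psi π - c ≤ x ⬝ᵥ leaderFeatures alg T c x := by
  have hT' : (0 : ℝ) < 2 * T := by positivity
  obtain ⟨h1, h2⟩ := halg ((1 / (2 * (T : ℝ))) • x) (c / (2 * (T : ℝ))) (by positivity)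
  have h3 := h1 π
  rw [M.value_eq_dotProduct_Psi, M.value_eq_dotProduct_Psi, ← h2, smul_dotProduct,
    smul_dotProduct, smul_eq_mul, smul_eq_mul] at h3
  have h4 := mul_le_mul_of_nonneg_left h3 hT'.le
  rw [leaderFeatures]
  have e : ∀ y : ℝ, 2 * (T : ℝ) * (1 / (2 * T) * y) = y := fun y => by field_simp
  have e' : 2 * (T : ℝ) * (c / (2 * T)) = c := by field_simp
  rwa [mul_sub, e, e, e'] at h4

theorem leaderFeatures_mem_range [Fintype S] {M : MDP S A k} (halg : alg.IsAdditiveApprox M)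
    (hT : 0 < T) (hc : 0 < c) (x : Vec k) : ∃ π : Policy S A, leaderFeatures alg T c x = M.Psi π :=
  ⟨_, (halg ((1 / (2 * (T : ℝ))) • x) (c / (2 * (T : ℝ))) (by positivity)).2⟩

/-- The value of the output policy is the mean of the values `w · μ_t`. -/
theorem mixedValue_fplOutput [Fintype S] [NeZero T] {M : MDP S A k}
    (halg : alg.IsAdditiveApprox M) (hc : 0 < c) (ω : Fin T → Vec k × Vec k) (w : Vec k) :
    M.mixedValue w (fplOutput alg SO c step ω) =
      (T : ℝ)⁻¹ * (w ⬝ᵥ (fplSums alg SO c step ω T).2) := by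
  have hT : 0 < T := NeZero.pos T
  rw [fplOutput, M.mixedValue_map_uniform]
  congr 1
  have hval : ∀ t : Fin T,
      M.value w ((fplIteration alg SO c step ω t).run alg SO).1 =
        w ⬝ᵥ ((fplSums alg SO c step ω (t + 1)).2 - (fplSums alg SO c step ω t).2) := fun t => by
    rw [fplSums_succ, add_sub_cancel_left, M.value_eq_dotProduct_Psi, leaderFeatures,
      (halg _ (c / (2 * (T : ℝ))) (by positivity)).2]
    simp only [fplIteration, fplRound, RoundProg.run, RoundProg.run_ofSep]
  rw [Finset.sum_congr rfl fun t _ => hval t, ← dotProduct_sum,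
    Fin.sum_univ_eq_sum_range (fun t => (fplSums alg SO c step ω (t + 1)).2 -
      (fplSums alg SO c step ω t).2), Finset.sum_range_sub (fun t => (fplSums alg SO c step ω t).2)]
  simp [fplSums]

end Sums

/-! ### The performance bound -/

theorem abs_dotProduct_le_sum_abs {k : ℕ} {w μ : Vec k} (hw : ∀ i, |w i| ≤ 1) :
    |w ⬝ᵥ μ| ≤ ∑ i, |μ i| := by
  refine (Finset.abs_sum_le_sum_abs _ _).trans (Finset.sum_le_sum fun i _ => ?_)
  rw [abs_mul]
  exact mul_le_of_le_one_left (abs_nonneg _) (hw i)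

theorem sum_abs_le_card {k : ℕ} {w : Vec k} (hw : ∀ i, |w i| ≤ 1) : ∑ i, |w i| ≤ (k : ℝ) := by
  simpa using Finset.sum_le_sum fun i (_ : i ∈ Finset.univ) => hw i

theorem fplNoiseSeq_eq_pi_uniformCube (k T : ℕ) :
    fplNoiseSeq k T = Measure.pi fun _ : Fin T =>
      (uniformCube k (k * √T)).prod (uniformCube k (k * √T)) := by
  simp only [fplNoiseSeq, fplNoise, fplDelta, one_div_one_div, uniformCube]

section Performance

variable {S : Type u} {A : Type v} {k T : ℕ}
  (SO : Vec k → SepAnswer k) (step : Vec k → SepProg k)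
  (alg : Solver S A k) (c : ℝ)

/-- The difference of two conditional mean payoffs in iteration `t`: that of the actual weights
`w_t`, averaged over the policy noise `p_t`, minus that of the actual feature vector `μ_t`, averaged
over the weight noise `q_t`. The increments of `fplSums` are `w_t` and `μ_t`. -/
noncomputable def payoffGap (t : ℕ) (ω : Fin T → Vec k × Vec k) : ℝ :=
  meanPayoff (k * √T) (leaderFeatures alg T c) (fplSums alg SO c step ω t).1
      ((fplSums alg SO c step ω (t + 1)).1 - (fplSums alg SO c step ω t).1) -
    meanPayoff (k * √T) (fun u => (step u).run SO) (fplSums alg SO c step ω t).2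
      ((fplSums alg SO c step ω (t + 1)).2 - (fplSums alg SO c step ω t).2)

variable {M : MDP S A k} {PR : Set (Vec k)} {SO step alg c} [NeZero T]

/-- The regrets of the two players, added up. The policy player loses at most `k² √T` through its
noise since noise and feature vectors are nonnegative; the weight player loses at most twice the
expected sum of the coordinates of its noise, which is `k² √T` as well. -/
theorem dotProduct_sub_le_sum_payoffGap [Fintype S] (hk : 0 < k)
    (hΨ : ∀ π : Policy S A, ∑ i, |M.Psi π i| ≤ (k : ℝ)) (hbd : ∀ w ∈ PR, ∀ i, |w i| ≤ 1)
    (hstep : ComputesArgmin step SO PR) (halg : alg.IsAdditiveApprox M)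
    (hfm : Measurable (leaderFeatures alg T c)) (hc : 0 < c) (ω : Fin T → Vec k × Vec k)
    (w : Vec k) (hw : w ∈ PR) (π : Policy S A) :
    (fplSums alg SO c step ω T).1 ⬝ᵥ M.Psi π - (fplSums alg SO c step ω T).2 ⬝ᵥ w ≤
      ∑ t ∈ Finset.range T, payoffGap SO step alg c t ω +
        (2 * (k : ℝ) ^ 2 + 4 * k) * √T + (T + 1) * c := by
  have hT : 0 < T := NeZero.pos T
  have hkR : (0 : ℝ) < k := by exact_mod_cast hk
  have hsT : 0 < √(T : ℝ) := Real.sqrt_pos.2 (by exact_mod_cast hT)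
  have hL : 0 < (k : ℝ) * √T := mul_pos hkR hsT
  have hprob := isProbabilityMeasure_uniformCube k hL
  set s := fplSums alg SO c step ω with hs
  set f := leaderFeatures alg T c with hf
  set h : Vec k → Vec k := fun u => (step u).run SO with hh
  have hfr : ∀ x, ∃ π : Policy S A, f x = M.Psi π := leaderFeatures_mem_range alg c halg hT hc
  have hfs : ∀ x, ∑ i, |f x i| ≤ (k : ℝ) := fun x => by
    obtain ⟨π', h'⟩ := hfr x
    rw [h']
    exact hΨ π'
  have hhm : ∀ x, h x ∈ PR := fun x => (hstep.2 x).1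
  have hW : ∀ t < T, ∃ y, (s (t + 1)).1 - (s t).1 = h y := fun t ht =>
    ⟨_, by
      have := fplSums_succ alg SO c step ω ⟨t, ht⟩
      simp only at this
      rw [hs, this, add_sub_cancel_left]⟩
  have hU : ∀ t < T, ∃ y, (s (t + 1)).2 - (s t).2 = f y := fun t ht =>
    ⟨_, by
      have := fplSums_succ alg SO c step ω ⟨t, ht⟩
      simp only at this
      rw [hs, this, add_sub_cancel_left]⟩
  have hpay : ∀ x y, |h x ⬝ᵥ f y| ≤ (k : ℝ) := fun x y =>
    (abs_dotProduct_le_sum_abs (hbd _ (hhm x))).trans (hfs y)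
  have hstable : (T : ℝ) * (2 * k * k / (k * √T)) = 2 * k * √T := by
    have : (T : ℝ) = √T * √T := (Real.mul_self_sqrt (Nat.cast_nonneg T)).symm
    rw [mul_div_assoc', div_eq_iff hL.ne']
    calc (T : ℝ) * (2 * k * k) = (√T * √T) * (2 * k * k) := by rw [← this]
      _ = 2 * k * √T * (k * √T) := by ring
  have hR1 := follow_the_perturbed_leader (ε := 1) (c := c) (L := k * √T) (B := k) (b := k)
    (by simp) hL f hfm (Set.range fun π : Policy S A => M.Psi π)
    (fun x => (hfr x).imp fun _ e => e.symm)
    (by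
      rintro x _ ⟨π', rfl⟩
      simpa using leaderFeatures_approx_max alg c halg hT hc x π')
    (fun t => (s t).1) rfl T
    (fun t ht x => by
      obtain ⟨y, e⟩ := hW t ht
      rw [e]
      exact hpay y x)
    (fun t ht => by
      obtain ⟨y, e⟩ := hW t ht
      simp only [e]
      exact sum_abs_le_card (hbd _ (hhm y)))
    (M.Psi π) ⟨π, rfl⟩ (fun _ => k * √T * k) (integrable_const _)
    (fun p hp => by
      have h0 : 0 ≤ p ⬝ᵥ M.Psi π :=
        Finset.sum_nonneg fun i _ => mul_nonneg (hp.1 i) (M.Psi_nonneg π i)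
      have h1 : p ⬝ᵥ f p ≤ k * √T * k := by
        calc p ⬝ᵥ f p ≤ ∑ i, k * √T * |f p i| := Finset.sum_le_sum fun i _ =>
              mul_le_mul (hp.2 i) (le_abs_self _) (by
                obtain ⟨π', e⟩ := hfr p
                rw [e]
                exact M.Psi_nonneg π' i) hL.le
          _ ≤ k * √T * k := by
              rw [← Finset.mul_sum]
              exact mul_le_mul_of_nonneg_left (hfs p) hL.le
      linarith)
  have hR2 := follow_the_perturbed_leader (ε := -1) (c := 0) (L := k * √T) (B := k) (b := k)
    (by simp) hL h hstep.1 PR hhm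
    (fun x w' hw' => by
      have := (hstep.2 x).2 w' hw'
      rw [dotProduct_comm x, dotProduct_comm x]
      linarith)
    (fun t => (s t).2) rfl T
    (fun t ht x => by
      obtain ⟨y, e⟩ := hU t ht
      rw [e, dotProduct_comm]
      exact hpay x y)
    (fun t ht => by
      obtain ⟨y, e⟩ := hU t ht
      simp only [e]
      exact hfs y)
    w hw (fun p => ∑ i, 2 * p i)
    (integrable_finsetSum _ fun i _ => (integrable_coord_uniformCube k hL i).const_mul 2)
    (fun p hp => by
      rw [← dotProduct_sub, neg_one_mul, ← dotProduct_neg, neg_sub]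
      refine Finset.sum_le_sum fun i _ => ?_
      have h1 := abs_le.1 (hbd w hw i)
      have h2 := abs_le.1 (hbd _ (hhm p) i)
      rw [mul_comm 2]
      refine mul_le_mul_of_nonneg_left ?_ (hp.1 i)
      simp only [Pi.sub_apply]
      linarith)
  have hN2 : ∫ p : Vec k, ∑ i, 2 * p i ∂uniformCube k (k * √T) = k * (k * √T) := by
    rw [integral_finsetSum _ fun i _ => (integrable_coord_uniformCube k hL i).const_mul 2]
    simp only [integral_const_mul, integral_coord_uniformCube k hL]
    rw [Finset.sum_const, Finset.card_univ, Fintype.card_fin, nsmul_eq_mul]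
    ring
  rw [hN2, hstable] at hR2
  rw [hstable] at hR1
  simp only [integral_const, probReal_univ, one_smul] at hR1
  simp only [payoffGap, Finset.sum_sub_distrib]
  linarith

theorem measurable_payoffGap (hk : 0 < k) (hstep : ComputesArgmin step SO PR)
    (hfm : Measurable (leaderFeatures alg T c)) (t : ℕ) :
    Measurable (payoffGap (T := T) SO step alg c t) := by
  have hL : 0 < (k : ℝ) * √T :=
    mul_pos (by exact_mod_cast hk) (Real.sqrt_pos.2 (by exact_mod_cast NeZero.pos T))
  have hm := measurable_fplSums alg SO c step hfm hstep.1
  refine Measurable.sub ?_ ?_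
  · exact (measurable_meanPayoff hL hfm).comp ((hm t).fst.prodMk ((hm (t + 1)).fst.sub (hm t).fst))
  · exact (measurable_meanPayoff hL hstep.1).comp
      ((hm t).snd.prodMk ((hm (t + 1)).snd.sub (hm t).snd))

/-- The sum of the gaps, a martingale with increments in `[-2k, 2k]`, exceeds `4 k √(T ln (1/ξ))`
with probability at most `ξ`. -/
theorem measure_le_sum_payoffGap_le [Fintype S] (hk : 0 < k)
    (hΨ : ∀ π : Policy S A, ∑ i, |M.Psi π i| ≤ (k : ℝ)) (hbd : ∀ w ∈ PR, ∀ i, |w i| ≤ 1)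
    (hstep : ComputesArgmin step SO PR) (halg : alg.IsAdditiveApprox M)
    (hfm : Measurable (leaderFeatures alg T c)) (hc : 0 < c) {ξ : ℝ} (hξ0 : 0 < ξ) (hξ1 : ξ < 1) :
    (Measure.pi fun _ : Fin T => (uniformCube k (k * √T)).prod (uniformCube k (k * √T)))
        {ω | 4 * k * (√T * √(Real.log (1 / ξ))) ≤
          ∑ t ∈ Finset.range T, payoffGap SO step alg c t ω} ≤ ENNReal.ofReal ξ := by
  have hT : 0 < T := NeZero.pos T
  have hkR : (0 : ℝ) < k := by exact_mod_cast hk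
  have hTR : (0 : ℝ) < T := by exact_mod_cast hT
  have hsT : 0 < √(T : ℝ) := Real.sqrt_pos.2 hTR
  have hL : 0 < (k : ℝ) * √T := mul_pos hkR hsT
  have hprob := isProbabilityMeasure_uniformCube k hL
  have hlog : 0 < Real.log (1 / ξ) := Real.log_pos (by rw [lt_div_iff₀ hξ0]; linarith)
  set l := √(Real.log (1 / ξ)) with hl
  have hl2 : l ^ 2 = Real.log (1 / ξ) := Real.sq_sqrt hlog.le
  have hT2 : √(T : ℝ) ^ 2 = T := Real.sq_sqrt hTR.le
  have hl0 : 0 < l := Real.sqrt_pos.2 hlog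
  -- The minimizer of `2 k² T r² - 4 k √T l r`.
  set r : ℝ := l / (k * √T) with hr
  have hr0 : 0 < r := div_pos hl0 hL
  have hmg := measurable_payoffGap (T := T) hk hstep hfm
  have hpay : ∀ x y, |(step x).run SO ⬝ᵥ leaderFeatures alg T c y| ≤ (k : ℝ) := fun x y => by
    obtain ⟨π, e⟩ := leaderFeatures_mem_range alg c halg hT hc y
    rw [e]
    exact (abs_dotProduct_le_sum_abs (hbd _ (hstep.2 x).1)).trans (hΨ π)
  have hexp := lintegral_exp_sum_le ((uniformCube k (k * √T)).prod (uniformCube k (k * √T)))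
    (T := T) (fun t ω => r * payoffGap SO step alg c t ω) (2 * (k : ℝ) ^ 2 * r ^ 2)
    (fun t => (hmg t).const_mul r)
    (fun t s hst ω x => by
      simp only [payoffGap]
      rw [fplSums_update alg SO c step ω t x s hst.le,
        fplSums_update alg SO c step ω t x (s + 1) hst])
    (fun t ω => by
      refine le_trans (le_of_eq ?_) (lintegral_exp_meanPayoff_sub_le hL hfm hstep.1 hpay
        (fplSums alg SO c step ω t).1 (fplSums alg SO c step ω t).2 r)
      refine lintegral_congr fun z => ?_
      have h1 := fplSums_update alg SO c step ω t z t le_rfl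
      have h2 := fplSums_succ alg SO c step (Function.update ω t z) t
      rw [h1, Function.update_self] at h2
      simp only [payoffGap, h1, h2, add_sub_cancel_left])
    T le_rfl
  simp only [← Finset.mul_sum] at hexp
  have hSm : Measurable fun ω => ENNReal.ofReal (Real.exp
      (r * ∑ t ∈ Finset.range T, payoffGap (T := T) SO step alg c t ω)) := by
    fun_prop
  have hpos : 0 < Real.exp (r * (4 * k * (√T * l))) := Real.exp_pos _
  have hmarkov := meas_ge_le_lintegral_div
    (μ := Measure.pi fun _ : Fin T => (uniformCube k (k * √T)).prod (uniformCube k (k * √T)))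
    hSm.aemeasurable (ε := ENNReal.ofReal (Real.exp (r * (4 * k * (√T * l)))))
    (by simpa using hpos) ENNReal.ofReal_ne_top
  refine (measure_mono fun ω hω => ?_).trans (hmarkov.trans ?_)
  · exact ENNReal.ofReal_le_ofReal (Real.exp_le_exp.2 (mul_le_mul_of_nonneg_left hω hr0.le))
  · refine (ENNReal.div_le_div_right hexp _).trans ?_
    rw [← ENNReal.ofReal_div_of_pos hpos, ← Real.exp_sub]
    refine ENNReal.ofReal_le_ofReal ?_
    have hr1 : r * (k * √T) = l := div_mul_cancel₀ _ hL.ne'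
    have hexpo : T * (2 * (k : ℝ) ^ 2 * r ^ 2) - r * (4 * k * (√T * l)) = -(2 * l ^ 2) := by
      calc T * (2 * (k : ℝ) ^ 2 * r ^ 2) - r * (4 * k * (√T * l))
          = 2 * (r * (k * √T)) ^ 2 - 4 * (r * (k * √T)) * l := by
            rw [← hT2]
            simp only [Real.sqrt_sq hsT.le]
            ring
        _ = -(2 * l ^ 2) := by
            rw [hr1]
            ring
    rw [hexpo, hl2]
    calc Real.exp (-(2 * Real.log (1 / ξ))) ≤ Real.exp (-Real.log (1 / ξ)) :=
          Real.exp_le_exp.2 (by linarith)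
      _ = ξ := by rw [one_div, Real.log_inv, neg_neg, Real.exp_log hξ0]

/-- Where the sum of the gaps is small, the output policy is good for all weights. -/
theorem maxmin_sub_le_mixedValue [Fintype S] (hk : 0 < k)
    (hΨ : ∀ π : Policy S A, ∑ i, |M.Psi π i| ≤ (k : ℝ)) (hconv : Convex ℝ PR)
    (hbd : ∀ w ∈ PR, ∀ i, |w i| ≤ 1) (hstep : ComputesArgmin step SO PR)
    (halg : alg.IsAdditiveApprox M) (hfm : Measurable (leaderFeatures alg T c)) (hc : 0 < c)
    {l : ℝ} (hl : 0 ≤ l) (ω : Fin T → Vec k × Vec k)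
    (hω : ∑ t ∈ Finset.range T, payoffGap SO step alg c t ω ≤ 4 * k * (√T * l))
    (w : Vec k) (hw : w ∈ PR) :
    M.maxmin PR - (k : ℝ) ^ 2 * (6 + 4 * l) / √T - 2 * c ≤
      M.mixedValue w (fplOutput alg SO c step ω) := by
  have hT : 0 < T := NeZero.pos T
  have hk1 : (1 : ℝ) ≤ k := by exact_mod_cast hk
  have hT1 : (1 : ℝ) ≤ T := by exact_mod_cast hT
  have hTR : (0 : ℝ) < T := by linarith
  have hsT : 0 < √(T : ℝ) := Real.sqrt_pos.2 hTR
  have hT2 : √(T : ℝ) * √T = T := Real.mul_self_sqrt hTR.le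
  have : Nonempty (Policy S A) := ⟨(alg 0 1).1⟩
  rw [mixedValue_fplOutput alg SO c step halg hc]
  suffices M.maxmin PR ≤ (T : ℝ)⁻¹ * (w ⬝ᵥ (fplSums alg SO c step ω T).2) +
      (k : ℝ) ^ 2 * (6 + 4 * l) / √T + 2 * c by linarith
  refine M.maxmin_le_of_forall_exists
    (fun w' hw' π => (abs_dotProduct_le_sum_abs (hbd w' hw')).trans (hΨ π)) fun π => ?_
  refine ⟨(T : ℝ)⁻¹ • (fplSums alg SO c step ω T).1, ?_, ?_⟩
  · have hsum : (fplSums alg SO c step ω T).1 = ∑ t : Fin T,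
        ((fplSums alg SO c step ω (t + 1)).1 - (fplSums alg SO c step ω t).1) := by
      rw [Fin.sum_univ_eq_sum_range (fun t => (fplSums alg SO c step ω (t + 1)).1 -
        (fplSums alg SO c step ω t).1),
        Finset.sum_range_sub (fun t => (fplSums alg SO c step ω t).1)]
      simp [fplSums]
    rw [hsum, Finset.smul_sum]
    refine hconv.sum_mem (fun _ _ => by positivity) (by simp [hTR.ne']) fun t _ => ?_
    rw [fplSums_succ, add_sub_cancel_left]
    exact (hstep.2 _).1
  · have h := dotProduct_sub_le_sum_payoffGap hk hΨ hbd hstep halg hfm hc ω w hw π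
    rw [dotProduct_comm (fplSums alg SO c step ω T).2] at h
    rw [smul_dotProduct, smul_eq_mul]
    have hdiv : (k : ℝ) ^ 2 * (6 + 4 * l) / √T = (T : ℝ)⁻¹ * (k ^ 2 * (6 + 4 * l) * √T) := by
      rw [div_eq_iff hsT.ne']
      calc (k : ℝ) ^ 2 * (6 + 4 * l) = ((T : ℝ)⁻¹ * T) * (k ^ 2 * (6 + 4 * l)) := by
            rw [inv_mul_cancel₀ hTR.ne', one_mul]
        _ = (T : ℝ)⁻¹ * (√T * √T) * (k ^ 2 * (6 + 4 * l)) := by rw [hT2]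
        _ = (T : ℝ)⁻¹ * (k ^ 2 * (6 + 4 * l) * √T) * √T := by ring
    have hcT : 2 * c = (T : ℝ)⁻¹ * (2 * T * c) := by field_simp
    rw [hdiv, hcT, ← mul_add, ← mul_add]
    refine mul_le_mul_of_nonneg_left ?_ (by positivity)
    have hkk : (k : ℝ) ≤ k ^ 2 := by nlinarith
    have h1 : (k : ℝ) * √T ≤ k ^ 2 * √T := mul_le_mul_of_nonneg_right hkk hsT.le
    have h2 : (k : ℝ) * (√T * l) ≤ k ^ 2 * (√T * l) :=
      mul_le_mul_of_nonneg_right hkk (mul_nonneg hsT.le hl)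
    have h3 : c ≤ T * c := le_mul_of_one_le_left hc.le hT1
    linarith

end Performance

theorem mainTheorem4 :
    -- performance, for every implementation `step` of the minimization over `P_R`
    (∀ (S : Type u) (A : Type v) [Fintype S] (k : ℕ) (M : MDP S A k) (PR : Set (Vec k))
        (SO : Vec k → SepAnswer k) (step : Vec k → SepProg k) (alg : Solver S A k)
        (T : ℕ) [NeZero T] (c ξ : ℝ),
      0 < k →
      (∀ π : Policy S A, ∑ i, |M.Psi π i| ≤ (k : ℝ)) →
      PR.Nonempty → IsClosed PR → Convex ℝ PR → (∀ w ∈ PR, ∀ i, |w i| ≤ 1) →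
      IsSeparationOracle SO PR →
      ComputesArgmin step SO PR →
      alg.IsAdditiveApprox M →
      (∀ η : ℝ, 0 < η → Measurable fun w : Vec k => (alg w η).2) →
      0 < c → 0 < ξ → ξ < 1 / 2 →
      ENNReal.ofReal (1 - 2 * ξ) ≤
        fplNoiseSeq k T {ω | ∀ w ∈ PR,
          M.maxmin PR - (k : ℝ) ^ 2 * (6 + 4 * Real.sqrt (Real.log (1 / ξ))) / Real.sqrt T - 2 * c
            ≤ M.mixedValue w (fplOutput alg SO c step ω)}) ∧
    -- oracle queries, for one implementation that depends only on `k` and the bit bound `ℓ`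
    (∃ (step : ∀ k : ℕ, ℕ → Vec k → SepProg k) (poly : Polynomial ℕ),
      ∀ (k ℓ : ℕ) (PR : Set (Vec k)) (SO : Vec k → SepAnswer k),
        PR.Nonempty → DescribedByBits PR ℓ → (∀ w ∈ PR, ∀ i, |w i| ≤ 1) →
        IsSeparationOracle SO PR →
        ComputesArgmin (step k ℓ) SO PR ∧
        ∀ (S : Type u) (A : Type v) (alg : Solver S A k) (T : ℕ) (c : ℝ)
            (ω : Fin T → Vec k × Vec k) (t : Fin T),
          (fplIteration alg SO c (step k ℓ) ω t).solverQueries alg SO =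
              [((1 / (2 * (T : ℝ))) • ((fplSums alg SO c (step k ℓ) ω t).1 + (ω t).1),
                c / (2 * (T : ℝ)))] ∧
            ((fplIteration alg SO c (step k ℓ) ω t).sepQueries alg SO).length
              ≤ poly.eval (k + ℓ)) := by
  refine ⟨fun S A _ k M PR SO step alg T _ c ξ hk hΨ _ _ hconv hbd _ hstep halg hmeas hc hξ0 hξ1 =>
    ?_, exists_step_with_polynomially_many_queries⟩
  have hT : (0 : ℝ) < T := by exact_mod_cast NeZero.pos T
  have hL : 0 < (k : ℝ) * √T := mul_pos (by exact_mod_cast hk) (Real.sqrt_pos.2 hT)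
  have hprob := isProbabilityMeasure_uniformCube k hL
  have hfm : Measurable (leaderFeatures alg T c) :=
    (hmeas (c / (2 * T)) (by positivity)).comp (measurable_const_smul _)
  have htail := measure_le_sum_payoffGap_le (T := T) hk hΨ hbd hstep halg hfm hc hξ0
    (by linarith)
  have hm : Measurable fun ω => ∑ t ∈ Finset.range T, payoffGap (T := T) SO step alg c t ω :=
    Finset.measurable_sum _ fun t _ => measurable_payoffGap hk hstep hfm t
  rw [fplNoiseSeq_eq_pi_uniformCube]
  refine le_trans ?_ (measure_mono (s := {ω | 4 * k * (√T * √(Real.log (1 / ξ))) ≤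
    ∑ t ∈ Finset.range T, payoffGap SO step alg c t ω}ᶜ) fun ω hω w hw => ?_)
  · rw [prob_compl_eq_one_sub (measurableSet_le measurable_const hm)]
    refine le_trans ?_ (tsub_le_tsub_left htail 1)
    rw [← ENNReal.ofReal_one, ← ENNReal.ofReal_sub _ hξ0.le]
    exact ENNReal.ofReal_le_ofReal (by linarith)
  · exact maxmin_sub_le_mixedValue hk hΨ hconv hbd hstep halg hfm hc (Real.sqrt_nonneg _) ω
      (not_le.1 fun h => hω h).le w hw
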